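/- Let $(\mathbb T^2,g)$ be an oriented Riemannian 2-torus (smooth metric), let $f\in C^\infty(\mathbb T^2)$ and let $\mathbf e$ be a smooth vector field on $\mathbb T^2$. Let $i$ denote the rotation of tangent vectors through $\pi/2$ according to the orientation, and for a unit tangent vector $v\in S_x\mathbb T^2$ put $$\lambda(x,v)=f(x)+\langle \mathbf e(x),iv\rangle .$$ A thermostat geodesic is a unit speed curve $\gamma:\mathbb R\to\mathbb T^2$ with $D_t\dot\gamma=\lambda(\gamma,\dot\gamma)\,i\dot\gamma$; let $\phi_t$ be the flow on the unit circle bundle $\pi:S\mathbb T^2\to\mathbb T^2$ which these curves define. For $x\in\mathbb T^2$ the exponential map $\exp^\lambda_x:T_x\mathbb T^2\setminus\{0\}\to\mathbb T^2$ is $$\exp^\lambda_x(tv)=\pi(\phi_t(x,v)),\qquad t>0,\ v\in S_x\mathbb T^2 ,$$ and the thermostat $(\mathbb T^2,g,f,\mathbf e)$ is said to have no conjugate points if $\exp^\lambda_x$ is a ($C^\infty$) local diffeomorphism for every $x\in\mathbb T^2$. Let $K$ be the Gaussian curvature of $g$, let $V$ be the vector field on $S\mathbb T^2$ generating the rotations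 $(x,v)\mapsto(x,\cos\theta\, v+\sin\theta\, iv)$, and let $H$ be the vector field on $S\mathbb T^2$ whose value at $(x,v)$ is the horizontal lift (with respect to the Levi-Civita connection) of $iv$. Theorem. The thermostat $(\mathbb T^2,g,f,\mathbf e)$ has no conjugate points if and only if, for every thermostat geodesic $\gamma:\mathbb R\to\mathbb T^2$, every solution $y:\mathbb R\to\mathbb R$, not identically zero, of the Jacobi equation $$\ddot y-V(\lambda)\,\dot y+\bigl(K-H(\lambda)+\lambda^2\bigr)y=0,$$ where $V(\lambda)$, $H(\lambda)$, $\lambda$ are evaluated at $(\gamma(t),\dot\gamma(t))$ and $K$ at $\gamma(t)$, vanishes for at most one $t\in\mathbb R$. -/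

import Mathlib

open scoped Manifold ContDiff Bundle

-- `ℝ²` as a manifold is always taken with its single identity chart.
attribute [local instance 2000] chartedSpaceSelf

noncomputable section

/-- The 2-torus `S¹ × S¹`, with the product smooth manifold structure. -/
abbrev Torus : Type := Circle × Circle

/-- The model vector space of the torus. -/
abbrev TorusModel : Type := EuclideanSpace ℝ (Fin 1) × EuclideanSpace ℝ (Fin 1)

/-- The model with corners of the torus. -/
abbrev torusI : ModelWithCorners ℝ TorusModel
    (ModelProd (EuclideanSpace ℝ (Fin 1)) (EuclideanSpace ℝ (Fin 1))) :=
  (𝓡 1).prod (𝓡 1)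

/-- The coordinate plane, which is the universal cover of the torus. -/
abbrev Plane : Type := EuclideanSpace ℝ (Fin 2)

/-- The universal covering `ℝ² → S¹ × S¹`, `(a, b) ↦ (exp(ia), exp(ib))`. The standard
coordinates of `ℝ²` serve as (global, multivalued) angular coordinates on the torus. Tangent
spaces of the torus are identified with `ℝ²` by the differential of this map. -/
def torusCover (p : Plane) : Torus := (Circle.exp (p 0), Circle.exp (p 1))

/-- A thermostat on an oriented Riemannian 2-torus: a smooth Riemannian metric `g`, one of the two
orientations, a smooth function `f` and a smooth vector field `e`. -/
structure Thermostat where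
  /-- the Riemannian metric -/
  g : Bundle.ContMDiffRiemannianMetric torusI ∞ TorusModel
    (fun x : Torus => TangentSpace torusI x)
  /-- the orientation: `1` if the coordinate frame `(∂₀, ∂₁)` is positive and `-1` otherwise -/
  orientation : ℤˣ
  /-- the magnetic part -/
  f : Torus → ℝ
  /-- the external field -/
  e : (x : Torus) → TangentSpace torusI x
  smooth_f : ContMDiff torusI 𝓘(ℝ, ℝ) ∞ f
  smooth_e : ContMDiff torusI torusI.tangent ∞
    (fun x : Torus => (⟨x, e x⟩ : TangentBundle torusI Torus))

/-- The partial derivative `∂ᵢ h` of a function on the plane. -/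
def partialDeriv (i : Fin 2) (h : Plane → ℝ) (p : Plane) : ℝ :=
  fderiv ℝ h p (EuclideanSpace.single i 1)

namespace Thermostat

/-- The differential of the covering map, `T_p ℝ² = ℝ² → T_x 𝕋²` with `x = torusCover p`. -/
def push (p v : Plane) : TangentSpace torusI (torusCover p) :=
  mfderiv 𝓘(ℝ, Plane) torusI torusCover p v

/-- The inner product `⟨u, v⟩` of tangent vectors at `p`, in coordinates. -/
def metric (T : Thermostat) (p u v : Plane) : ℝ :=
  T.g.inner (torusCover p) (push p u) (push p v)

/-- The matrix `(g_{ij})` of the metric at `p`. -/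
def gram (T : Thermostat) (p : Plane) : Matrix (Fin 2) (Fin 2) ℝ :=
  Matrix.of fun i j => T.metric p (EuclideanSpace.single i 1) (EuclideanSpace.single j 1)

/-- The rotation `v ↦ iv` through `π/2` according to the orientation: `iv` is orthogonal to `v`,
has the same length, and `(v, iv)` is positively oriented if `v ≠ 0`. -/
def rot (T : Thermostat) (p v : Plane) : Plane :=
  (((T.orientation : ℤ) : ℝ) / √(T.gram p).det) •
    !₂[-(T.gram p 0 1 * v 0 + T.gram p 1 1 * v 1), T.gram p 0 0 * v 0 + T.gram p 0 1 * v 1]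

/-- The Christoffel symbol `Γᵏᵢⱼ` of the Levi-Civita connection. -/
def christoffel (T : Thermostat) (k i j : Fin 2) (p : Plane) : ℝ :=
  1 / 2 * ∑ l, (T.gram p)⁻¹ k l *
    (partialDeriv i (fun q => T.gram q j l) p + partialDeriv j (fun q => T.gram q i l) p
      - partialDeriv l (fun q => T.gram q i j) p)

/-- The vector `Γ(u, v)` with components `∑ᵢⱼ Γᵏᵢⱼ uᵢ vⱼ`. -/
def connection (T : Thermostat) (p u v : Plane) : Plane :=
  WithLp.toLp 2 fun k => ∑ i, ∑ j, T.christoffel k i j p * u i * v j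

/-- The component `Rˡₖᵢⱼ` of the curvature tensor, `R(∂ᵢ, ∂ⱼ)∂ₖ = ∑ₗ Rˡₖᵢⱼ ∂ₗ`. -/
def riemann (T : Thermostat) (l k i j : Fin 2) (p : Plane) : ℝ :=
  partialDeriv i (T.christoffel l j k) p - partialDeriv j (T.christoffel l i k) p
    + ∑ m, (T.christoffel l i m p * T.christoffel m j k p
      - T.christoffel l j m p * T.christoffel m i k p)

/-- The Gaussian curvature `K = ⟨R(∂₀, ∂₁)∂₁, ∂₀⟩ / det (g_{ij})`. -/
def gaussCurvature (T : Thermostat) (p : Plane) : ℝ :=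
  (∑ l, T.gram p 0 l * T.riemann l 1 0 1 p) / (T.gram p).det

/-- The function `λ(x, v) = f(x) + ⟨e(x), iv⟩`. -/
def lam (T : Thermostat) (p v : Plane) : ℝ :=
  T.f (torusCover p) + T.g.inner (torusCover p) (T.e (torusCover p)) (push p (T.rot p v))

/-- `V(λ)` at `(x, v)`, where `V` generates the rotations `(x, v) ↦ (x, (cos θ) v + (sin θ) iv)`. -/
def Vlam (T : Thermostat) (p v : Plane) : ℝ :=
  deriv (fun θ : ℝ => T.lam p (Real.cos θ • v + Real.sin θ • T.rot p v)) 0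

/-- `H(λ)` at `(x, v)`, where `H` is the horizontal lift of `iv`, that is, the tangent vector to
the unit circle bundle which projects to `iv` and along which `v` is transported parallelly; in
coordinates `H = (iv, -Γ(iv, v))`. -/
def Hlam (T : Thermostat) (p v : Plane) : ℝ :=
  fderiv ℝ (fun q : Plane × Plane => T.lam q.1 q.2) (p, v)
    (T.rot p v, -T.connection p (T.rot p v) v)

/-- The covariant derivative `D_t ċ` of the velocity of a curve. -/
def acceleration (T : Thermostat) (c : ℝ → Plane) (t : ℝ) : Plane :=
  deriv (deriv c) t + T.connection (c t) (deriv c t) (deriv c t)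

/-- `c` is (the lift to the plane of) a thermostat geodesic: it has unit speed and
`D_t ċ = λ(c, ċ) iċ`. -/
def IsGeodesic (T : Thermostat) (c : ℝ → Plane) : Prop :=
  ContDiff ℝ 2 c ∧ (∀ t, T.metric (c t) (deriv c t) (deriv c t) = 1) ∧
    ∀ t, T.acceleration c t = T.lam (c t) (deriv c t) • T.rot (c t) (deriv c t)

open Classical in
/-- The thermostat geodesic `t ↦ π(φ_t(p, v))` with initial position `p` and initial velocity the
unit vector `v`, lifted to the plane (and the constant curve `p` if there is none, which for unit
vectors does not happen). -/
def geodesic (T : Thermostat) (p v : Plane) : ℝ → Plane :=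
  if h : ∃ c : ℝ → Plane, T.IsGeodesic c ∧ c 0 = p ∧ deriv c 0 = v then h.choose else fun _ => p

/-- The norm `|v|` of a tangent vector. -/
def gnorm (T : Thermostat) (p v : Plane) : ℝ := √(T.metric p v v)

/-- The exponential map at `x = torusCover p`, from `T_x 𝕋² = ℝ²` to the torus:
`tv ↦ π(φ_t(x, v))` for `t > 0` and unit vectors `v`. -/
def exp (T : Thermostat) (p w : Plane) : Torus :=
  torusCover (T.geodesic p ((T.gnorm p w)⁻¹ • w) (T.gnorm p w))

/-- The thermostat has no conjugate points: every exponential map is a local diffeomorphism on its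
domain, which is the set of the vectors `tv` with `t > 0` and `v` a unit vector. -/
def NoConjugatePoints (T : Thermostat) : Prop :=
  ∀ p : Plane, IsLocalDiffeomorphOn 𝓘(ℝ, Plane) torusI ∞ (T.exp p) {w | w ≠ 0}

/-- `y` solves the Jacobi equation `ÿ - V(λ) ẏ + (K - H(λ) + λ²) y = 0` along the curve `c`. -/
def IsJacobiSolution (T : Thermostat) (c : ℝ → Plane) (y : ℝ → ℝ) : Prop :=
  ContDiff ℝ 2 y ∧ ∀ t, deriv (deriv y) t - T.Vlam (c t) (deriv c t) * deriv y t
    + (T.gaussCurvature (c t) - T.Hlam (c t) (deriv c t) + T.lam (c t) (deriv c t) ^ 2) * y t = 0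

end Thermostat

end

/-! Work on the universal cover, with `F = X + λV` the generator of the thermostat flow `φ` on the
unit circle bundle (`X` the geodesic field). The lifted exponential map sends rays to geodesics and
circles to wave fronts. Its differential at `tv` therefore maps `v` to the velocity at time `t` and
`t • iv` to `J(t)`, the projection of `dφ_t(V)`. It is injective exactly when `J(t)` is not tangent
to the geodesic, that is, when the normal component `y = ⟨J, iγ̇⟩` is nonzero
(`injective_fderiv_liftedExp_iff`). Dimensions being equal, the inverse function theorem turns
injective differentials into local diffeomorphisms.

This `y` solves the Jacobi equation. Put `x = ⟨J, γ̇⟩` and `u = ⟨D_t J, iγ̇⟩`. Since speed is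
preserved, `D_t J` stays normal to `γ̇`, and `x' = λy`, `y' = u - λx`, `u' = dλ(J, Q) - Ky`, where
`Q = J'` in coordinates. In the frame `F, H, V` the vector `(J, Q)` is `xF + yH + y'V`, so the terms
`x F(λ)` cancel in `y''` and the Jacobi equation remains (`isJacobiSolution`). Moreover `y(0) = 0`
and `y'(0) = 1`.

Absence of conjugate points thus says that these special solutions have no zero at positive time
(`noConjugatePoints_iff`). By uniqueness, any Jacobi solution with a zero at `a` is a multiple of
the special solution started at `γ(a)` (`eq_smul_jacobiField`), which gives the equivalence.

The analytic input is a complete smooth flow. The spray is quadratic in the velocity, hence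
unbounded, so it is cut off away from energy `1`; periodicity makes the result bounded, and
conservation of energy (`metric_flow`) makes the cutoff invisible on unit vectors. Smoothness of the
flow follows by induction from the linearized equation and Grönwall's inequality. -/

noncomputable section

/-! ### Smooth dependence of solutions on initial data -/

section ODE

open Set Metric
open scoped NNReal Topology

universe u

variable {E : Type u} [NormedAddCommGroup E]

lemma exists_norm_le_of_continuousOn_Icc {γ : ℝ → E} {a b : ℝ} (h : ContinuousOn γ (Icc a b)) :
    ∃ R : ℝ, 0 < R ∧ ∀ t ∈ Icc a b, ‖γ t‖ ≤ R := by
  obtain ⟨R, hR⟩ := isCompact_Icc.exists_bound_of_continuousOn h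
  exact ⟨max R 1, by positivity, fun t ht => (hR t ht).trans (le_max_left _ _)⟩

variable [NormedSpace ℝ E]

lemma IsIntegralCurveOn.hasDerivWithinAt_Ici {γ : ℝ → E} {f : ℝ → E → E} {a b t : ℝ}
    (h : IsIntegralCurveOn γ f (Icc a b)) (ht : t ∈ Ico a b) :
    HasDerivWithinAt γ (f t (γ t)) (Ici t) t :=
  (h t (Ico_subset_Icc_self ht)).mono_of_mem_nhdsWithin (Icc_mem_nhdsGE_of_mem ht)

/-- Picard-Lindelöf for a bounded, locally Lipschitz time-dependent vector field: solutions exist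
on the whole time interval. -/
lemma exists_isIntegralCurveOn_Icc_of_bounded [CompleteSpace E] {f : ℝ → E → E} {a b t₀ M : ℝ}
    (ht₀ : t₀ ∈ Icc a b) (x₀ : E)
    (hlip : ∀ R : ℝ, ∃ K : ℝ≥0, ∀ t ∈ Icc a b, LipschitzOnWith K (f t) (closedBall x₀ R))
    (hcont : ∀ x, ContinuousOn (f · x) (Icc a b)) (hM : ∀ t ∈ Icc a b, ∀ x, ‖f t x‖ ≤ M) :
    ∃ γ : ℝ → E, γ t₀ = x₀ ∧ IsIntegralCurveOn γ f (Icc a b) := by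
  have hM0 : 0 ≤ M := (norm_nonneg _).trans (hM t₀ ht₀ x₀)
  have hab : 0 ≤ b - a := sub_nonneg.2 (ht₀.1.trans ht₀.2)
  obtain ⟨K, hK⟩ := hlip (M * (b - a))
  -- With speed at most `M`, a solution cannot leave the ball of radius `M * (b - a)` during the
  -- interval, so this radius imposes no restriction on time.
  have hP : IsPicardLindelof f (⟨t₀, ht₀⟩ : Icc a b) x₀ ⟨M * (b - a), mul_nonneg hM0 hab⟩ 0
      ⟨M, hM0⟩ K := by
    refine ⟨hK, fun x _ => hcont x, fun t ht x _ => hM t ht x, ?_⟩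
    have : max (b - t₀) (t₀ - a) ≤ b - a := max_le (by linarith [ht₀.1]) (by linarith [ht₀.2])
    rw [NNReal.coe_zero, sub_zero]
    exact mul_le_mul_of_nonneg_left this hM0
  exact hP.exists_eq_forall_mem_Icc_hasDerivWithinAt₀

/-- A `C¹` map on a finite-dimensional space is Lipschitz on closed balls. -/
lemma ContDiff.exists_lipschitzOnWith_closedBall {F : Type*} [NormedAddCommGroup F]
    [NormedSpace ℝ F] [FiniteDimensional ℝ E] {f : E → F} (hf : ContDiff ℝ 1 f) (x : E) (R : ℝ) :
    ∃ K : ℝ≥0, LipschitzOnWith K f (closedBall x R) := by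
  obtain ⟨C, hC⟩ := (isCompact_closedBall x R).exists_bound_of_continuousOn
    (hf.continuous_fderiv one_ne_zero).continuousOn
  refine ⟨⟨max C 0, le_max_right _ _⟩, (convex_closedBall x R).lipschitzOnWith_of_nnnorm_fderiv_le
    (fun y _ => hf.differentiable one_ne_zero y) fun y hy => ?_⟩
  exact (hC y hy).trans (le_max_left _ _)

variable [FiniteDimensional ℝ E]

/-- Both curves stay in one compact ball, on which the `C¹` field is Lipschitz; a global Lipschitz
constant is not needed. -/
lemma IsIntegralCurveOn.eqOn_Icc {F : E → E} (hF : ContDiff ℝ 1 F) {γ₁ γ₂ : ℝ → E} {b : ℝ}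
    (h₁ : IsIntegralCurveOn γ₁ (fun _ => F) (Icc 0 b))
    (h₂ : IsIntegralCurveOn γ₂ (fun _ => F) (Icc 0 b)) (h : γ₁ 0 = γ₂ 0) :
    EqOn γ₁ γ₂ (Icc 0 b) := by
  obtain ⟨R₁, -, hR₁⟩ := exists_norm_le_of_continuousOn_Icc h₁.continuousOn
  obtain ⟨R₂, -, hR₂⟩ := exists_norm_le_of_continuousOn_Icc h₂.continuousOn
  obtain ⟨K, hK⟩ := hF.exists_lipschitzOnWith_closedBall 0 (max R₁ R₂)
  refine ODE_solution_unique_of_mem_Icc_right (v := fun _ => F)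
    (s := fun _ => closedBall 0 (max R₁ R₂)) (fun _ _ => hK) h₁.continuousOn
    (fun t ht => h₁.hasDerivWithinAt_Ici ht) (fun t ht => ?_) h₂.continuousOn
    (fun t ht => h₂.hasDerivWithinAt_Ici ht) (fun t ht => ?_) h
  · exact mem_closedBall_zero_iff.2 ((hR₁ t (Ico_subset_Icc_self ht)).trans (le_max_left _ _))
  · exact mem_closedBall_zero_iff.2 ((hR₂ t (Ico_subset_Icc_self ht)).trans (le_max_right _ _))

/-- A smooth vector field may be cut off to a globally Lipschitz one outside of a ball. -/
lemma ContDiff.exists_cutoff {F : E → E} (hF : ContDiff ℝ 1 F) {R : ℝ} (hR : 0 < R) :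
    ∃ G : E → E, ∃ K : ℝ≥0, ∃ M : ℝ, LipschitzWith K G ∧ (∀ x, ‖G x‖ ≤ M) ∧
      (∀ x, ‖x‖ ≤ R → G x = F x) ∧ (∀ x, ‖G x‖ ≤ ‖F x‖) := by
  let χ : ContDiffBump (0 : E) := ⟨R, R + 1, hR, by linarith⟩
  have hG : ContDiff ℝ 1 (fun x => χ x • F x) := χ.contDiff.smul hF
  have hs : HasCompactSupport (fun x => χ x • F x) := χ.hasCompactSupport.smul_right
  obtain ⟨K, hK⟩ := hG.lipschitzWith_of_hasCompactSupport hs one_ne_zero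
  obtain ⟨M, hM⟩ := hs.exists_bound_of_continuous hG.continuous
  refine ⟨_, K, M, hK, hM, fun x hx => ?_, fun x => ?_⟩
  · simp [χ.one_of_mem_closedBall (mem_closedBall_zero_iff.2 hx)]
  · rw [norm_smul, Real.norm_of_nonneg χ.nonneg]
    exact mul_le_of_le_one_left (norm_nonneg _) χ.le_one

/-- Linear differential equations have solutions on the whole time interval. -/
lemma exists_isIntegralCurveOn_Icc_linear {A : ℝ → E →L[ℝ] E} (hA : ContinuousOn A (Icc 0 1))
    (x₀ : E) :
    ∃ γ : ℝ → E, γ 0 = x₀ ∧ IsIntegralCurveOn γ (fun t x => A t x) (Icc 0 1) := by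
  obtain ⟨L, hL0, hL⟩ := exists_norm_le_of_continuousOn_Icc hA
  -- Grönwall's a priori bound, enlarged to be positive. The equation is solved with `x` cut off
  -- beyond this radius, and the solution never reaches the cutoff.
  set R : ℝ := (‖x₀‖ + 1) * Real.exp L
  obtain ⟨G, K, M, hK, hM, hG, hGle⟩ :=
    (contDiff_id (𝕜 := ℝ) (E := E) (n := 1)).exists_cutoff (R := R) (by positivity)
  have hbd : ∀ t ∈ Icc (0 : ℝ) 1, ∀ x, ‖A t (G x)‖ ≤ L * ‖x‖ := fun t ht x =>
    ((A t).le_opNorm _).trans (mul_le_mul (hL t ht) (hGle x) (norm_nonneg _) hL0.le)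
  obtain ⟨γ, hγ0, hγ⟩ := exists_isIntegralCurveOn_Icc_of_bounded (f := fun t x => A t (G x))
    (M := L * M) (left_mem_Icc.2 zero_le_one) x₀
    (fun _ => ⟨⟨L, hL0.le⟩ * K, fun t ht => LipschitzWith.lipschitzOnWith
      (((A t).lipschitz.weaken (hL t ht)).comp hK)⟩)
    (fun x => hA.clm_apply continuousOn_const)
    (fun t ht x => ((A t).le_opNorm _).trans
      (mul_le_mul (hL t ht) (hM x) (norm_nonneg _) hL0.le))
  refine ⟨γ, hγ0, fun t ht => ?_⟩
  have hle : ‖γ t‖ ≤ R := by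
    have h := norm_le_gronwallBound_of_norm_deriv_right_le (δ := ‖x₀‖) (K := L) (ε := 0)
      hγ.continuousOn (fun s hs => hγ.hasDerivWithinAt_Ici hs) (by rw [hγ0])
      (fun s hs => by simpa using hbd s (Ico_subset_Icc_self hs) (γ s)) t ht
    rw [gronwallBound_ε0, sub_zero] at h
    refine h.trans (mul_le_mul (by linarith) (Real.exp_le_exp.2 ?_) (Real.exp_pos _).le
      (by positivity))
    nlinarith [ht.2]
  simpa [hG _ hle] using hγ t ht

/-- Solutions depend Lipschitz continuously on the initial point, locally. -/
lemma exists_norm_sub_le_of_isIntegralCurveOn {F : E → E} (hF : ContDiff ℝ 1 F) {φ : E → ℝ → E}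
    (h0 : ∀ x, φ x 0 = x) (h : ∀ x, IsIntegralCurveOn (φ x) (fun _ => F) (Icc 0 1)) (x : E) :
    ∃ C R δ : ℝ, 0 < δ ∧ 0 ≤ C ∧ ∀ v : E, ‖v‖ < δ → ∀ t ∈ Icc (0 : ℝ) 1,
      ‖φ x t‖ ≤ R ∧ ‖φ (x + v) t‖ ≤ R ∧ ‖φ (x + v) t - φ x t‖ ≤ C * ‖v‖ := by
  obtain ⟨R, hR0, hR⟩ := exists_norm_le_of_continuousOn_Icc (h x).continuousOn
  obtain ⟨G, K, M, hK, hM, hG, -⟩ := hF.exists_cutoff (R := R + 1) (by positivity)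
  have hx : IsIntegralCurveOn (φ x) (fun _ => G) (Icc 0 1) := fun t ht => by
    simpa [hG _ ((hR t ht).trans (by linarith))] using h x t ht
  -- The choice `δ = exp (-K)` keeps the perturbed curve within distance `1` of the original, hence
  -- in the ball of radius `R + 1` where the cut off field is still `F`.
  refine ⟨Real.exp K, R + 1, Real.exp (-K), Real.exp_pos _, (Real.exp_pos _).le, fun v hv => ?_⟩
  obtain ⟨γ, hγ0, hγ⟩ := exists_isIntegralCurveOn_Icc_of_bounded (f := fun _ => G)
    (M := M) (left_mem_Icc.2 zero_le_one) (x + v) (fun _ => ⟨K, fun _ _ => hK.lipschitzOnWith⟩)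
    (fun x => continuousOn_const) (fun _ _ => hM)
  have hd : ∀ t ∈ Icc (0 : ℝ) 1, ‖γ t - φ x t‖ ≤ Real.exp K * ‖v‖ := fun t ht => by
    have := dist_le_of_trajectories_ODE (v := fun _ => G) (fun _ => hK) hγ.continuousOn
      (fun s hs => hγ.hasDerivWithinAt_Ici hs) hx.continuousOn
      (fun s hs => hx.hasDerivWithinAt_Ici hs) (δ := ‖v‖) (by simp [hγ0, h0, dist_eq_norm]) t ht
    rw [dist_eq_norm, mul_comm] at this
    refine this.trans (mul_le_mul_of_nonneg_right (Real.exp_le_exp.2 ?_) (norm_nonneg _))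
    nlinarith [ht.2, K.2]
  have hle : ∀ t ∈ Icc (0 : ℝ) 1, ‖γ t‖ ≤ R + 1 := fun t ht => by
    have h1 : Real.exp K * ‖v‖ ≤ 1 := by
      calc Real.exp K * ‖v‖ ≤ Real.exp K * Real.exp (-K) := by gcongr
        _ = 1 := by rw [← Real.exp_add]; simp
    have := norm_le_norm_add_norm_sub' (γ t) (φ x t)
    linarith [hR t ht, hd t ht]
  have heq : EqOn (φ (x + v)) γ (Icc 0 1) := (h (x + v)).eqOn_Icc hF
    (fun t ht => by simpa [hG _ (hle t ht)] using hγ t ht) (by rw [h0, hγ0])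
  intro t ht
  rw [heq ht]
  exact ⟨(hR t ht).trans (by linarith), hle t ht, hd t ht⟩

/-- With no initial error the bound is linear in the forcing term, so a forcing of order `‖v‖ ^ 2`
leaves an error of order `‖v‖ ^ 2`. -/
lemma gronwallBound_zero_eq_mul (K ε x : ℝ) :
    gronwallBound 0 K ε x = ε * gronwallBound 0 K 1 x := by
  unfold gronwallBound
  split_ifs <;> ring

/-- A `C²` map agrees with its linear approximations on balls up to a quadratic error. -/
lemma ContDiff.exists_norm_sub_fderiv_le {F : E → E} (hF : ContDiff ℝ 2 F) (R : ℝ) :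
    ∃ C : ℝ, 0 ≤ C ∧ ∀ a b : E, ‖a‖ ≤ R → ‖b‖ ≤ R →
      ‖F b - F a - fderiv ℝ F a (b - a)‖ ≤ C * ‖b - a‖ ^ 2 := by
  obtain ⟨K, hK⟩ := (hF.fderiv_right (m := 1) (by norm_num)).exists_lipschitzOnWith_closedBall 0 R
  refine ⟨K, K.2, fun a b ha hb => ?_⟩
  have hseg : segment ℝ a b ⊆ closedBall (0 : E) R :=
    (convex_closedBall 0 R).segment_subset (mem_closedBall_zero_iff.2 ha)
      (mem_closedBall_zero_iff.2 hb)
  have := (convex_segment a b).norm_image_sub_le_of_norm_hasFDerivWithin_le' (f := F)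
    (f' := fderiv ℝ F) (φ := fderiv ℝ F a) (C := K * ‖b - a‖)
    (fun x _ => (hF.differentiable two_ne_zero x).hasFDerivAt.hasFDerivWithinAt)
    (fun x hx => ?_) (left_mem_segment ℝ a b) (right_mem_segment ℝ a b)
  · rwa [mul_assoc, ← pow_two] at this
  · refine (hK.norm_sub_le (hseg hx) (mem_closedBall_zero_iff.2 ha)).trans ?_
    gcongr
    obtain ⟨s, hs, rfl⟩ := (segment_eq_image' ℝ a b) ▸ hx
    rw [add_sub_cancel_left, norm_smul, Real.norm_of_nonneg hs.1]
    exact mul_le_of_le_one_left (norm_nonneg _) hs.2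

/-- The time one map is differentiable, and its derivative is the time one map of the linearized
equation. -/
lemma hasFDerivAt_timeOne {F : E → E} (hF : ContDiff ℝ 2 F) {φ : E → ℝ → E}
    (h0 : ∀ x, φ x 0 = x) (h : ∀ x, IsIntegralCurveOn (φ x) (fun _ => F) (Icc 0 1)) (x : E)
    {U : ℝ → E →L[ℝ] E} (hU0 : U 0 = ContinuousLinearMap.id ℝ E)
    (hU : IsIntegralCurveOn U (fun t B => (fderiv ℝ F (φ x t)).comp B) (Icc 0 1)) :
    HasFDerivAt (fun y => φ y 1) (U 1) x := by
  obtain ⟨C, R, δ, hδ, hC0, hC⟩ :=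
    exists_norm_sub_le_of_isIntegralCurveOn (hF.of_le one_le_two) h0 h x
  obtain ⟨C', hC'0, hC'⟩ := hF.exists_norm_sub_fderiv_le R
  obtain ⟨L, hL0, hL⟩ := exists_norm_le_of_continuousOn_Icc
    ((hF.continuous_fderiv two_ne_zero).comp_continuousOn (h x).continuousOn)
  rw [hasFDerivAt_iff_isLittleO_nhds_zero]
  refine Asymptotics.IsBigO.trans_isLittleO (g := fun v : E => ‖v‖ ^ 2)
    (Asymptotics.IsBigO.of_bound (C' * C ^ 2 * gronwallBound 0 L 1 1) ?_)
    (Asymptotics.isLittleO_norm_pow_id one_lt_two)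
  filter_upwards [Metric.ball_mem_nhds (0 : E) hδ] with v hv
  rw [mem_ball_zero_iff] at hv
  have hr : ∀ t ∈ Icc (0 : ℝ) 1, HasDerivWithinAt (fun t => φ (x + v) t - φ x t - U t v)
      (F (φ (x + v) t) - F (φ x t) - fderiv ℝ F (φ x t) (U t v)) (Icc 0 1) t := fun t ht =>
    ((h (x + v) t ht).sub (h x t ht)).sub ((hU t ht).clm_apply (hasDerivWithinAt_const t _ v)
      |>.congr_deriv (by simp))
  have hgr := norm_le_gronwallBound_of_norm_deriv_right_le (δ := 0) (K := L)
    (ε := C' * C ^ 2 * ‖v‖ ^ 2) (fun t ht => (hr t ht).continuousWithinAt)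
    (fun t ht => (hr t (Ico_subset_Icc_self ht)).mono_of_mem_nhdsWithin (Icc_mem_nhdsGE_of_mem ht))
    (by simp [h0, hU0]) (fun t ht => ?_) 1 (right_mem_Icc.2 zero_le_one)
  · rw [sub_zero, gronwallBound_zero_eq_mul] at hgr
    refine hgr.trans (le_of_eq ?_)
    rw [norm_pow, norm_norm]
    ring
  · have ht := Ico_subset_Icc_self ht
    obtain ⟨h1, h2, h3⟩ := hC v hv t ht
    -- The remainder satisfies the linearized equation up to the Taylor error of `F`, which is
    -- quadratic in the separation of the two curves.
    have e : F (φ (x + v) t) - F (φ x t) - fderiv ℝ F (φ x t) (U t v)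
        = fderiv ℝ F (φ x t) (φ (x + v) t - φ x t - U t v)
          + (F (φ (x + v) t) - F (φ x t) - fderiv ℝ F (φ x t) (φ (x + v) t - φ x t)) := by
      simp only [map_sub]; abel
    rw [e]
    refine (norm_add_le _ _).trans (add_le_add ?_ ?_)
    · exact ((fderiv ℝ F (φ x t)).le_opNorm _).trans
        (mul_le_mul_of_nonneg_right (hL t ht) (norm_nonneg _))
    · refine (hC' _ _ h1 h2).trans ?_
      rw [mul_assoc, ← mul_pow]
      gcongr

/-- The variational equation, solved in the space of operators; its value at time one is the
candidate for the derivative of the time one map. -/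
lemma exists_linearization {F : E → E} (hF : ContDiff ℝ 2 F) {γ : ℝ → E}
    (h : ContinuousOn γ (Icc 0 1)) :
    ∃ U : ℝ → E →L[ℝ] E, U 0 = ContinuousLinearMap.id ℝ E ∧
      IsIntegralCurveOn U (fun t B => (fderiv ℝ F (γ t)).comp B) (Icc 0 1) :=
  exists_isIntegralCurveOn_Icc_linear
    (A := fun t => ContinuousLinearMap.compL ℝ E E E (fderiv ℝ F (γ t)))
    ((ContinuousLinearMap.compL ℝ E E E).continuous.comp_continuousOn
      ((hF.continuous_fderiv two_ne_zero).comp_continuousOn h)) _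

/-- The time one map of a complete smooth vector field is `Cⁿ` for all finite `n`. -/
lemma contDiff_nat_timeOne (n : ℕ) : ∀ {E : Type u} [NormedAddCommGroup E] [NormedSpace ℝ E]
    [FiniteDimensional ℝ E] {F : E → E}, ContDiff ℝ ∞ F → ∀ {φ : E → ℝ → E},
    (∀ x, φ x 0 = x) → (∀ x, IsIntegralCurveOn (φ x) (fun _ => F) (Icc 0 1)) →
    ContDiff ℝ n (fun x => φ x 1) := by
  induction n with
  | zero =>
    intro E _ _ _ F hF φ h0 h
    have hF2 : ContDiff ℝ 2 F := hF.of_le ENat.LEInfty.out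
    refine contDiff_zero.2 (continuous_iff_continuousAt.2 fun x => ?_)
    obtain ⟨U, hU0, hU⟩ := exists_linearization hF2 (h x).continuousOn
    exact (hasFDerivAt_timeOne hF2 h0 h x hU0 hU).continuousAt
  | succ n ih =>
    intro E _ _ _ F hF φ h0 h
    have hF2 : ContDiff ℝ 2 F := hF.of_le ENat.LEInfty.out
    choose U hU0 hU using fun x => exists_linearization hF2 (h x).continuousOn
    have hd : ∀ x, HasFDerivAt (fun y => φ y 1) (U x 1) x := fun x =>
      hasFDerivAt_timeOne hF2 h0 h x (hU0 x) (hU x)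
    -- The tangent lift of `F`: its flow is `(x, v) ↦ (φ x, Dφ x v)`, so the induction hypothesis on
    -- `E × E` gives `Cⁿ` regularity of the derivative. This is why the induction quantifies over
    -- all spaces.
    have hG : ContDiff ℝ ∞ (fun z : E × E => (F z.1, fderiv ℝ F z.1 z.2)) :=
      (hF.comp contDiff_fst).prodMk
        (((hF.fderiv_right (m := ∞) (by simp)).comp contDiff_fst).clm_apply contDiff_snd)
    have key := ih hG (φ := fun z t => (φ z.1 t, U z.1 t z.2)) (fun z => by simp [h0, hU0])
      (fun z t ht => (h z.1 t ht).prodMk ((hU z.1 t ht).clm_apply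
        (hasDerivWithinAt_const t _ z.2) |>.congr_deriv (by simp)))
    rw [show ((n + 1 : ℕ) : WithTop ℕ∞) = (n : WithTop ℕ∞) + 1 by push_cast; rfl,
      contDiff_succ_iff_fderiv]
    refine ⟨fun x => (hd x).differentiableAt, by simp, ?_⟩
    rw [contDiff_clm_apply_iff]
    intro y
    have : (fun x => fderiv ℝ (fun y => φ y 1) x y) = fun x => U x 1 y := by
      ext x; rw [(hd x).fderiv]
    rw [this]
    exact (contDiff_snd.comp key).comp (contDiff_id.prodMk contDiff_const)

/-- The flow of a complete smooth vector field is smooth. -/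
theorem contDiff_flow {F : E → E} (hF : ContDiff ℝ ∞ F) {φ : ℝ → E → E}
    (h0 : ∀ x, φ 0 x = x) (h : ∀ t x, HasDerivAt (fun s => φ s x) (F (φ t x)) t) :
    ContDiff ℝ ∞ (fun z : ℝ × E => φ z.1 z.2) := by
  -- Time becomes an initial value: the time one map of `(τ, x) ↦ (0, τ F x)` is `(τ, x) ↦ (τ, φ_τ
  -- x)`, which gives joint smoothness.
  have hG : ContDiff ℝ ∞ (fun z : ℝ × E => ((0 : ℝ), z.1 • F z.2)) :=
    contDiff_const.prodMk (contDiff_fst.smul (hF.comp contDiff_snd))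
  refine contDiff_infty.2 fun n => ?_
  have key := contDiff_nat_timeOne n
    (E := ℝ × E) (F := fun z => (0, z.1 • F z.2)) ?_
    (φ := fun z t => (z.1, φ (t * z.1) z.2)) (fun z => by simp [h0]) (fun z t ht => ?_)
  · simpa [Function.comp_def] using contDiff_snd.comp key
  · exact hG
  · refine HasDerivAt.hasDerivWithinAt ((hasDerivAt_const t z.1).prodMk ?_)
    have := (h (t * z.1) z.2).scomp t ((hasDerivAt_id t).mul_const z.1)
    simpa [Function.comp_def] using this

/-- The derivative of a smooth flow in the initial point solves the linearized equation. -/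
theorem hasDerivAt_fderiv_flow {F : E → E} (hF : ContDiff ℝ ∞ F) {φ : ℝ → E → E}
    (h0 : ∀ x, φ 0 x = x) (h : ∀ t x, HasDerivAt (fun s => φ s x) (F (φ t x)) t) (x u : E) (t : ℝ) :
    HasDerivAt (fun s => fderiv ℝ (φ s) x u) (fderiv ℝ F (φ t x) (fderiv ℝ (φ t) x u)) t := by
  set Φ : ℝ × E → E := fun z => φ z.1 z.2
  have hΦ : ContDiff ℝ ∞ Φ := contDiff_flow hF h0 h
  have hdΦ : Differentiable ℝ Φ := hΦ.differentiable (by simp)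
  have hd2 : Differentiable ℝ (fderiv ℝ Φ) :=
    (hΦ.fderiv_right (m := ∞) (by simp)).differentiable (by simp)
  have e1 : ∀ s y w, fderiv ℝ (φ s) y w = fderiv ℝ Φ (s, y) (0, w) := fun s y w => by
    have : HasFDerivAt (φ s) ((fderiv ℝ Φ (s, y)).comp (ContinuousLinearMap.inr ℝ ℝ E)) y :=
      HasFDerivAt.comp y (hdΦ (s, y)).hasFDerivAt (hasFDerivAt_prodMk_right s y)
    rw [this.fderiv]; rfl
  have e2 : ∀ s y, fderiv ℝ Φ (s, y) (1, 0) = F (φ s y) := fun s y => by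
    have : HasDerivAt (fun r => Φ (r, y)) (fderiv ℝ Φ (s, y) (1, 0)) s :=
      (hdΦ (s, y)).hasFDerivAt.comp_hasDerivAt (f := fun r => (r, y)) s ((hasDerivAt_id s).prodMk (hasDerivAt_const s y))
    exact this.unique (h s y)
  have e3 : HasDerivAt (fun s => fderiv ℝ Φ (s, x) (0, u))
      (fderiv ℝ (fderiv ℝ Φ) (t, x) (1, 0) (0, u)) t := by
    have := (hd2 (t, x)).hasFDerivAt.comp_hasDerivAt t
      ((hasDerivAt_id t).prodMk (hasDerivAt_const t x))
    simpa using this.clm_apply (hasDerivAt_const t ((0 : ℝ), u))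
  have e4 : fderiv ℝ (fderiv ℝ Φ) (t, x) (0, u) (1, 0)
      = fderiv ℝ F (φ t x) (fderiv ℝ (φ t) x u) := by
    have a1 : HasFDerivAt (fun y => fderiv ℝ Φ (t, y) (1, 0))
        (((fderiv ℝ (fderiv ℝ Φ) (t, x)).comp (ContinuousLinearMap.inr ℝ ℝ E)).flip (1, 0)) x := by
      have := (HasFDerivAt.comp x (hd2 (t, x)).hasFDerivAt (hasFDerivAt_prodMk_right t x))
      simpa using this.clm_apply (hasFDerivAt_const ((1 : ℝ), (0 : E)) x)
    have a2 : HasFDerivAt (fun y => F (φ t y)) ((fderiv ℝ F (φ t x)).comp (fderiv ℝ (φ t) x)) x :=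
      HasFDerivAt.comp x (hF.differentiable (by simp) _).hasFDerivAt
        ((hdΦ.comp (differentiable_const t |>.prodMk differentiable_id)) x).hasFDerivAt
    simp_rw [e2] at a1
    have := congrArg (fun L => L u) (a1.unique a2)
    simpa using this
  -- Symmetry of the second derivative exchanges `∂_t` and `∂_x`, so the flow equation may be
  -- differentiated in `x`.
  have hsymm := (hΦ.contDiffAt (x := (t, x))).isSymmSndFDerivAt
    (by simpa using ENat.LEInfty.out)
  simp_rw [e1]
  rw [← e1, ← e4, ← hsymm.eq]
  exact e3

end ODE

/-! ### Global solutions and uniqueness -/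

section GlobalODE

open Set Metric
open scoped NNReal Topology

variable {E : Type*} [NormedAddCommGroup E] [NormedSpace ℝ E] [FiniteDimensional ℝ E]

lemma eqOn_Icc_of_hasDerivAt {F : E → E} (hF : ContDiff ℝ 1 F) {γ₁ γ₂ : ℝ → E} {a b t₀ : ℝ}
    (ht₀ : t₀ ∈ Ioo a b) (h₁ : IsIntegralCurveOn γ₁ (fun _ => F) (Icc a b))
    (h₂ : IsIntegralCurveOn γ₂ (fun _ => F) (Icc a b)) (h : γ₁ t₀ = γ₂ t₀) :
    EqOn γ₁ γ₂ (Icc a b) := by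
  obtain ⟨R₁, -, hR₁⟩ := exists_norm_le_of_continuousOn_Icc h₁.continuousOn
  obtain ⟨R₂, -, hR₂⟩ := exists_norm_le_of_continuousOn_Icc h₂.continuousOn
  obtain ⟨K, hK⟩ := hF.exists_lipschitzOnWith_closedBall 0 (max R₁ R₂)
  refine ODE_solution_unique_of_mem_Icc (v := fun _ => F)
    (s := fun _ => closedBall 0 (max R₁ R₂)) (fun _ _ => hK) ht₀ h₁.continuousOn
    (fun t ht => (h₁ t (Ioo_subset_Icc_self ht)).hasDerivAt (Icc_mem_nhds ht.1 ht.2))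
    (fun t ht => ?_) h₂.continuousOn
    (fun t ht => (h₂ t (Ioo_subset_Icc_self ht)).hasDerivAt (Icc_mem_nhds ht.1 ht.2))
    (fun t ht => ?_) h
  · exact mem_closedBall_zero_iff.2 ((hR₁ t (Ioo_subset_Icc_self ht)).trans (le_max_left _ _))
  · exact mem_closedBall_zero_iff.2 ((hR₂ t (Ioo_subset_Icc_self ht)).trans (le_max_right _ _))

/-- Global solutions of an autonomous equation agree if they agree at one time. -/
lemma eq_of_hasDerivAt {F : E → E} (hF : ContDiff ℝ 1 F) {γ₁ γ₂ : ℝ → E} {t₀ : ℝ}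
    (h₁ : ∀ t, HasDerivAt γ₁ (F (γ₁ t)) t) (h₂ : ∀ t, HasDerivAt γ₂ (F (γ₂ t)) t)
    (h : γ₁ t₀ = γ₂ t₀) : γ₁ = γ₂ := by
  funext t
  refine eqOn_Icc_of_hasDerivAt hF (a := min t t₀ - 1) (b := max t t₀ + 1) (t₀ := t₀) ?_
    (fun s _ => (h₁ s).hasDerivWithinAt) (fun s _ => (h₂ s).hasDerivWithinAt) h ?_
  · exact ⟨by linarith [min_le_right t t₀], by linarith [le_max_right t t₀]⟩
  · exact ⟨by linarith [min_le_left t t₀], by linarith [le_max_left t t₀]⟩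

/-- A bounded `C¹` vector field is complete. -/
lemma exists_hasDerivAt_of_bounded {F : E → E} (hF : ContDiff ℝ 1 F) {M : ℝ}
    (hM : ∀ x, ‖F x‖ ≤ M) (x : E) : ∃ γ : ℝ → E, γ 0 = x ∧ ∀ t, HasDerivAt γ (F (γ t)) t := by
  have hex : ∀ T : ℝ, 0 < T →
      ∃ γ : ℝ → E, γ 0 = x ∧ IsIntegralCurveOn γ (fun _ => F) (Icc (-T) T) := fun T hT =>
    exists_isIntegralCurveOn_Icc_of_bounded ⟨by linarith, hT.le⟩ x
      (fun R => (hF.exists_lipschitzOnWith_closedBall x R).imp fun K hK _ _ => hK)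
      (fun _ => continuousOn_const) (fun _ _ => hM)
  choose! γ hγ0 hγ using hex
  -- The solutions on different symmetric intervals agree where both are defined, so reading off `γ
  -- (|t| + 1)` at time `t` glues them.
  have key : ∀ T, 0 < T → ∀ t ∈ Icc (-T) T, γ (|t| + 1) t = γ T t := fun T hT t ht => by
    have hmin : 0 < min (|t| + 1) T := lt_min (by positivity) hT
    refine eqOn_Icc_of_hasDerivAt hF (a := -(min (|t| + 1) T)) (b := min (|t| + 1) T) (t₀ := 0)
      ⟨by linarith, hmin⟩
      ((hγ _ (by positivity)).mono (Icc_subset_Icc (neg_le_neg (min_le_left _ _)) (min_le_left _ _)))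
      ((hγ _ hT).mono (Icc_subset_Icc (neg_le_neg (min_le_right _ _)) (min_le_right _ _)))
      (by rw [hγ0 _ (by positivity), hγ0 _ hT]) ?_
    rw [mem_Icc, ← abs_le]
    exact le_min (by linarith) (abs_le.2 ht)
  refine ⟨fun t => γ (|t| + 1) t, hγ0 _ (by positivity), fun t => ?_⟩
  have hT : 0 < |t| + 1 := by positivity
  have hmem : Icc (-(|t| + 1)) (|t| + 1) ∈ 𝓝 t :=
    Icc_mem_nhds (by linarith [neg_abs_le t]) (by linarith [le_abs_self t])
  refine ((hγ _ hT t (mem_of_mem_nhds hmem)).hasDerivAt hmem).congr_of_eventuallyEq ?_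
  filter_upwards [hmem] with s hs using key _ hT s hs

/-- A bounded smooth vector field has a smooth flow. -/
theorem exists_flow_of_bounded {F : E → E} (hF : ContDiff ℝ ∞ F) {M : ℝ} (hM : ∀ x, ‖F x‖ ≤ M) :
    ∃ φ : ℝ → E → E, (∀ x, φ 0 x = x) ∧ ∀ t x, HasDerivAt (fun s => φ s x) (F (φ t x)) t := by
  choose γ h0 h using exists_hasDerivAt_of_bounded (hF.of_le ENat.LEInfty.out) hM
  exact ⟨fun t x => γ x t, h0, fun t x => h x t⟩

/-- Solutions of a linear homogeneous second order equation with continuous coefficients are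
determined by their initial values. -/
lemma eq_of_second_order_linear {p q y z : ℝ → ℝ} (hp : Continuous p) (hq : Continuous q)
    (hy : ContDiff ℝ 2 y) (hz : ContDiff ℝ 2 z)
    (hy' : ∀ t, deriv (deriv y) t - p t * deriv y t + q t * y t = 0)
    (hz' : ∀ t, deriv (deriv z) t - p t * deriv z t + q t * z t = 0) {t₀ : ℝ}
    (h0 : y t₀ = z t₀) (h1 : deriv y t₀ = deriv z t₀) : y = z := by
  have hcurve : ∀ {y : ℝ → ℝ}, ContDiff ℝ 2 y →
      (∀ t, deriv (deriv y) t - p t * deriv y t + q t * y t = 0) → ∀ t,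
      HasDerivAt (fun s => (y s, deriv y s)) (deriv y t, p t * deriv y t - q t * y t) t := by
    intro y hy hy' t
    have hd : ContDiff ℝ 1 (deriv y) := by
      rw [show (2 : WithTop ℕ∞) = 1 + 1 by norm_num, contDiff_succ_iff_deriv] at hy
      exact hy.2.2
    refine HasDerivAt.prodMk (hy.differentiable two_ne_zero t).hasDerivAt ?_
    convert (hd.differentiable one_ne_zero t).hasDerivAt using 1
    linarith [hy' t]
  funext t
  set a := min t t₀ - 1
  set b := max t t₀ + 1
  obtain ⟨P, hP0, hP⟩ := exists_norm_le_of_continuousOn_Icc (hp.continuousOn (s := Icc a b))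
  obtain ⟨Q, hQ0, hQ⟩ := exists_norm_le_of_continuousOn_Icc (hq.continuousOn (s := Icc a b))
  -- The equation becomes a first order system for `(y, y')`, uniformly Lipschitz on the compact
  -- interval.
  have hlip : ∀ s ∈ Ioo a b, LipschitzOnWith (⟨1 + P + Q, by positivity⟩ : ℝ≥0)
      (fun w : ℝ × ℝ => (w.2, p s * w.2 - q s * w.1)) univ := by
    intro s hs
    refine LipschitzWith.lipschitzOnWith (LipschitzWith.of_dist_le_mul fun w w' => ?_)
    have h1 : |w.1 - w'.1| ≤ ‖w - w'‖ := norm_fst_le (w - w')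
    have h2 : |w.2 - w'.2| ≤ ‖w - w'‖ := norm_snd_le (w - w')
    have hp := hP s (Ioo_subset_Icc_self hs)
    have hq := hQ s (Ioo_subset_Icc_self hs)
    rw [dist_eq_norm, dist_eq_norm]
    change ‖_‖ ≤ (1 + P + Q) * _
    rw [Prod.mk_sub_mk, Prod.norm_mk]
    refine max_le ?_ ?_
    · rw [Real.norm_eq_abs]
      nlinarith [norm_nonneg (w - w')]
    · have : p s * w.2 - q s * w.1 - (p s * w'.2 - q s * w'.1)
          = p s * (w.2 - w'.2) - q s * (w.1 - w'.1) := by ring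
      rw [this]
      refine (norm_sub_le _ _).trans ?_
      rw [norm_mul, norm_mul]
      have e1 : ‖p s‖ * ‖w.2 - w'.2‖ ≤ P * ‖w - w'‖ :=
        mul_le_mul hp h2 (norm_nonneg _) hP0.le
      have e2 : ‖q s‖ * ‖w.1 - w'.1‖ ≤ Q * ‖w - w'‖ :=
        mul_le_mul hq h1 (norm_nonneg _) hQ0.le
      nlinarith [norm_nonneg (w - w')]
  have := ODE_solution_unique_of_mem_Icc (v := fun s w => (w.2, p s * w.2 - q s * w.1))
    (s := fun _ => univ) (f := fun s => (y s, deriv y s)) (g := fun s => (z s, deriv z s))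
    (t₀ := t₀) hlip
    ⟨by linarith [min_le_right t t₀], by linarith [le_max_right t t₀]⟩
    (fun s _ => (hcurve hy hy' s).continuousAt.continuousWithinAt) (fun s _ => hcurve hy hy' s)
    (fun _ _ => mem_univ _)
    (fun s _ => (hcurve hz hz' s).continuousAt.continuousWithinAt) (fun s _ => hcurve hz hz' s)
    (fun _ _ => mem_univ _) (by simp [h0, h1])
    (show t ∈ Icc a b from ⟨by linarith [min_le_left t t₀], by linarith [le_max_left t t₀]⟩)
  exact congrArg Prod.fst this

end GlobalODE

/-! ### The covering of the torus and periodicity of lifted data -/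

section TorusCover

open Set
open scoped Topology

lemma contMDiff_coe_circle : ContMDiff (𝓡 1) 𝓘(ℝ, ℂ) ∞ (fun z : Circle => (z : ℂ)) :=
  have : Fact (Module.finrank ℝ ℂ = 1 + 1) := finrank_real_complex_fact'
  contMDiff_coe_sphere (E := ℂ) (n := 1)

lemma contMDiff_torusCover : ContMDiff 𝓘(ℝ, Plane) torusI ∞ torusCover := by
  have h (i : Fin 2) : ContMDiff 𝓘(ℝ, Plane) 𝓘(ℝ, ℝ) ∞ (fun p : Plane => p i) :=
    (EuclideanSpace.proj i : Plane →L[ℝ] ℝ).contDiff.contMDiff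
  exact (contMDiff_circleExp.comp (h 0)).prodMk (contMDiff_circleExp.comp (h 1))

lemma torusCover_add (p k : Plane) (hk : torusCover k = 1) :
    torusCover (p + k) = torusCover p := by
  have h0 : Circle.exp (k 0) = 1 := congrArg Prod.fst hk
  have h1 : Circle.exp (k 1) = 1 := congrArg Prod.snd hk
  simp [torusCover, Circle.exp_add, h0, h1]

/-- The angle of `z` relative to `exp (ia)`, a local inverse of the exponential near `a`. -/
def Circle.argNear (a : ℝ) (z : Circle) : ℝ := a + Complex.arg (z * Circle.exp (-a) : Circle)

lemma Circle.exp_argNear (a : ℝ) (z : Circle) : Circle.exp (Circle.argNear a z) = z := by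
  rw [Circle.argNear, Circle.exp_add, Circle.exp_arg, mul_comm, mul_assoc, ← Circle.exp_add]
  simp

lemma Circle.argNear_exp {a b : ℝ} (h : |b - a| < Real.pi) :
    Circle.argNear a (Circle.exp b) = b := by
  rw [abs_lt] at h
  rw [Circle.argNear, ← Circle.exp_add, ← sub_eq_add_neg, Circle.arg_exp h.1 h.2.le]
  ring

lemma Circle.abs_argNear_sub_lt {a : ℝ} {z : Circle}
    (h : ((z * Circle.exp (-a) : Circle) : ℂ) ∈ Complex.slitPlane) :
    |Circle.argNear a z - a| < Real.pi := by
  rw [Circle.argNear, add_sub_cancel_left, abs_lt]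
  exact ⟨Complex.neg_pi_lt_arg _, lt_of_le_of_ne (Complex.arg_le_pi _)
    (Complex.mem_slitPlane_iff_arg.1 h).1⟩

lemma Circle.exp_mul_exp_mem_slitPlane {a b : ℝ} (h : |b - a| < Real.pi) :
    ((Circle.exp b * Circle.exp (-a) : Circle) : ℂ) ∈ Complex.slitPlane := by
  rw [abs_lt] at h
  rw [Complex.mem_slitPlane_iff_arg, ← Circle.exp_add, ← sub_eq_add_neg,
    Circle.arg_exp h.1 h.2.le]
  exact ⟨h.2.ne, Circle.coe_ne_zero _⟩

lemma Circle.contMDiffAt_argNear {a : ℝ} {z : Circle}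
    (h : ((z * Circle.exp (-a) : Circle) : ℂ) ∈ Complex.slitPlane) :
    ContMDiffAt (𝓡 1) 𝓘(ℝ, ℝ) ∞ (Circle.argNear a) z := by
  -- The argument is the imaginary part of the logarithm, which is smooth on the slit plane.
  have hlog : ContDiffAt ℝ ∞ (fun w : ℂ => a + (Complex.log (w * (Circle.exp (-a) : ℂ))).im) z := by
    have h1 : ContDiffAt ℝ ∞ (fun w : ℂ => w * (Circle.exp (-a) : ℂ)) z :=
      contDiffAt_id.mul contDiffAt_const
    have h2 : ContDiffAt ℝ ∞ Complex.log ((z : ℂ) * (Circle.exp (-a) : ℂ)) :=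
      (Complex.contDiffAt_log h).restrict_scalars ℝ
    exact contDiffAt_const.add (Complex.imCLM.contDiff.contDiffAt.comp (z : ℂ)
      (ContDiffAt.comp (g := Complex.log) (z : ℂ) h2 h1))
  refine (hlog.contMDiffAt.comp z contMDiff_coe_circle.contMDiffAt).congr_of_eventuallyEq
    (Filter.Eventually.of_forall fun w => ?_)
  change a + Complex.arg (w * Circle.exp (-a)) = a + (Complex.log (w * Circle.exp (-a))).im
  rw [Complex.log_im]

/-- The covering map of the torus, restricted to a square of side `2π` around a point. -/
def torusCoverPartialDiffeomorph (p : Plane) :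
    PartialDiffeomorph 𝓘(ℝ, Plane) torusI Plane Torus ∞ where
  toFun := torusCover
  invFun z := !₂[Circle.argNear (p 0) z.1, Circle.argNear (p 1) z.2]
  source := {q | |q 0 - p 0| < Real.pi ∧ |q 1 - p 1| < Real.pi}
  target := {z | ((z.1 * Circle.exp (-p 0) : Circle) : ℂ) ∈ Complex.slitPlane ∧
    ((z.2 * Circle.exp (-p 1) : Circle) : ℂ) ∈ Complex.slitPlane}
  map_source' q hq := ⟨Circle.exp_mul_exp_mem_slitPlane hq.1, Circle.exp_mul_exp_mem_slitPlane hq.2⟩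
  map_target' z hz := by
    simpa using ⟨Circle.abs_argNear_sub_lt hz.1, Circle.abs_argNear_sub_lt hz.2⟩
  left_inv' q hq := by
    ext i
    fin_cases i
    · exact Circle.argNear_exp hq.1
    · exact Circle.argNear_exp hq.2
  right_inv' z hz := by
    simp [torusCover, Circle.exp_argNear]
  open_source := by
    have h (i : Fin 2) : IsOpen {q : Plane | |q i - p i| < Real.pi} :=
      isOpen_lt (by fun_prop) continuous_const
    exact (h 0).inter (h 1)
  open_target := by
    have h0 : Continuous fun z : Torus => ((z.1 * Circle.exp (-p 0) : Circle) : ℂ) := by fun_prop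
    have h1 : Continuous fun z : Torus => ((z.2 * Circle.exp (-p 1) : Circle) : ℂ) := by fun_prop
    exact (Complex.isOpen_slitPlane.preimage h0).inter (Complex.isOpen_slitPlane.preimage h1)
  contMDiffOn_toFun := contMDiff_torusCover.contMDiffOn
  contMDiffOn_invFun z hz := by
    refine ContMDiffAt.contMDiffWithinAt ?_
    have h0 : ContMDiffAt torusI 𝓘(ℝ, ℝ) ∞ (fun z : Torus => Circle.argNear (p 0) z.1) z :=
      (Circle.contMDiffAt_argNear hz.1).comp z contMDiffAt_fst
    have h1 : ContMDiffAt torusI 𝓘(ℝ, ℝ) ∞ (fun z : Torus => Circle.argNear (p 1) z.2) z :=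
      (Circle.contMDiffAt_argNear hz.2).comp z contMDiffAt_snd
    have hc (i : Fin 2) : ContMDiffAt torusI 𝓘(ℝ, Plane) ∞
        (fun _ : Torus => (EuclideanSpace.single i 1 : Plane)) z := contMDiffAt_const
    refine ((h0.smul (hc 0)).add (h1.smul (hc 1))).congr_of_eventuallyEq (Filter.Eventually.of_forall fun w => ?_)
    ext i
    fin_cases i <;> simp

lemma isLocalDiffeomorphAt_torusCover (p : Plane) :
    IsLocalDiffeomorphAt 𝓘(ℝ, Plane) torusI ∞ torusCover p :=
  ⟨torusCoverPartialDiffeomorph p, by simp [torusCoverPartialDiffeomorph, Real.pi_pos],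
    fun _ _ => rfl⟩

namespace Thermostat

lemma push_injective (p : Plane) : Function.Injective (push p) :=
  ((isLocalDiffeomorphAt_torusCover p).mfderivToContinuousLinearEquiv (by simp)).injective

/-- The differential of the covering map as a linear map. -/
def pushL (p : Plane) : Plane →L[ℝ] TorusModel := mfderiv 𝓘(ℝ, Plane) torusI torusCover p

lemma contMDiff_push (u : Plane) : ContMDiff 𝓘(ℝ, Plane) torusI.tangent ∞
    (fun p : Plane => (⟨torusCover p, push p u⟩ : TangentBundle torusI Torus)) := by
  have h1 : ContMDiff 𝓘(ℝ, Plane) 𝓘(ℝ, Plane).tangent ∞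
      (fun p : Plane => (⟨p, u⟩ : TangentBundle 𝓘(ℝ, Plane) Plane)) :=
    contMDiff_vectorSpace_iff_contDiff.2 contDiff_const
  exact (contMDiff_torusCover.contMDiff_tangentMap (m := ∞) le_rfl).comp h1

variable (T : Thermostat)

lemma contDiff_inner {v w : (p : Plane) → TangentSpace torusI (torusCover p)}
    (hv : ContMDiff 𝓘(ℝ, Plane) torusI.tangent ∞
      (fun p => (⟨torusCover p, v p⟩ : TangentBundle torusI Torus)))
    (hw : ContMDiff 𝓘(ℝ, Plane) torusI.tangent ∞
      (fun p => (⟨torusCover p, w p⟩ : TangentBundle torusI Torus))) :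
    ContDiff ℝ ∞ (fun p => T.g.inner (torusCover p) (v p) (w p)) := by
  let _ : Bundle.RiemannianBundle (fun x : Torus => TangentSpace torusI x) := ⟨T.g.toRiemannianMetric⟩
  have := ContMDiff.inner_bundle (IB := torusI) (F := TorusModel)
    (E := fun x : Torus => TangentSpace torusI x) hv hw
  exact this.contDiff

/-- The components `⟨e, ∂ᵢ⟩` of the external field. -/
def field (i : Fin 2) (p : Plane) : ℝ :=
  T.g.inner (torusCover p) (T.e (torusCover p)) (push p (EuclideanSpace.single i 1))

lemma contDiff_gram (i j : Fin 2) : ContDiff ℝ ∞ (fun p => T.gram p i j) :=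
  T.contDiff_inner (contMDiff_push _) (contMDiff_push _)

lemma contDiff_field (i : Fin 2) : ContDiff ℝ ∞ (T.field i) :=
  T.contDiff_inner (T.smooth_e.comp contMDiff_torusCover) (contMDiff_push _)

lemma contDiff_magnetic : ContDiff ℝ ∞ (fun p => T.f (torusCover p)) :=
  (T.smooth_f.comp contMDiff_torusCover).contDiff

lemma eq_sum_single (v : Plane) :
    v = v 0 • EuclideanSpace.single (0 : Fin 2) (1 : ℝ) +
      v 1 • EuclideanSpace.single (1 : Fin 2) (1 : ℝ) := by
  ext i; fin_cases i <;> simp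

lemma push_eq_sum (p v : Plane) : push p v =
    v 0 • push p (EuclideanSpace.single 0 1) + v 1 • push p (EuclideanSpace.single 1 1) := by
  have : pushL p v = v 0 • pushL p (EuclideanSpace.single 0 1)
      + v 1 • pushL p (EuclideanSpace.single 1 1) := by
    conv_lhs => rw [eq_sum_single v]
    rw [map_add, map_smul, map_smul]
  exact this

lemma gram_symm (p : Plane) (i j : Fin 2) : T.gram p i j = T.gram p j i :=
  T.g.symm _ _ _

lemma metric_eq (p u v : Plane) : T.metric p u v =
    T.gram p 0 0 * u 0 * v 0 + T.gram p 0 1 * (u 0 * v 1 + u 1 * v 0) +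
      T.gram p 1 1 * u 1 * v 1 := by
  have : T.metric p u v = T.gram p 0 0 * u 0 * v 0 + T.gram p 0 1 * u 0 * v 1
      + T.gram p 1 0 * u 1 * v 0 + T.gram p 1 1 * u 1 * v 1 := by
    simp only [metric, gram, Matrix.of_apply]
    rw [push_eq_sum p u, push_eq_sum p v]
    simp only [map_add, map_smul, add_apply, smul_apply,
      smul_eq_mul]
    ring
  rw [this, T.gram_symm p 1 0]
  ring

lemma lam_eq (p v : Plane) : T.lam p v = T.f (torusCover p) +
    (T.field 0 p * T.rot p v 0 + T.field 1 p * T.rot p v 1) := by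
  rw [lam, push_eq_sum, map_add, map_smul, map_smul]
  simp only [field, smul_eq_mul]
  ring

lemma metric_pos (p : Plane) {v : Plane} (hv : v ≠ 0) : 0 < T.metric p v v := by
  refine T.g.pos _ _ fun h => hv (push_injective p ?_)
  exact h.trans (map_zero (pushL p)).symm

/-- The covering map is invariant under the translation by `k`, whose differential is the identity.
The ascription to `TorusModel` allows comparison of vectors in fibres over points that are only
propositionally equal. -/
lemma push_periodic {k : Plane} (hk : torusCover k = 1) (p v : Plane) :
    (push (p + k) v : TorusModel) = (push p v : TorusModel) := by
  have h1 : torusCover = torusCover ∘ (fun q : Plane => q + k) :=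
    funext fun q => (torusCover_add q k hk).symm
  have h2 : HasMFDerivAt 𝓘(ℝ, Plane) 𝓘(ℝ, Plane) (fun q : Plane => q + k) p
      (ContinuousLinearMap.id ℝ Plane) :=
    ((hasFDerivAt_id p).add_const k).hasMFDerivAt
  have h3 := (((contMDiff_torusCover (p + k)).mdifferentiableAt (by simp)).hasMFDerivAt).comp p h2
  rw [← h1] at h3
  rw [push, push, h3.mfderiv]
  rfl

/-- Transports inner products along an equality of base points; it is used to descend lifted
coefficients through deck translations. -/
lemma inner_congr {x y : Torus} (h : x = y) {v w v' w' : TorusModel} (hv : v = v') (hw : w = w') :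
    T.g.inner x (v : TangentSpace torusI x) (w : TangentSpace torusI x) =
      T.g.inner y (v' : TangentSpace torusI y) (w' : TangentSpace torusI y) := by
  subst h hv hw
  rfl

variable {T} in
lemma gram_periodic {k : Plane} (hk : torusCover k = 1) (p : Plane) :
    T.gram (p + k) = T.gram p := by
  ext i j
  exact T.inner_congr (torusCover_add p k hk) (push_periodic hk p _) (push_periodic hk p _)

variable {T} in
lemma field_periodic {k : Plane} (hk : torusCover k = 1) (i : Fin 2) (p : Plane) :
    T.field i (p + k) = T.field i p := by
  refine T.inner_congr (torusCover_add p k hk) ?_ (push_periodic hk p _)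
  rw [torusCover_add p k hk]

end Thermostat

end TorusCover

/-! ### Levi-Civita connection and rotation in coordinates -/

section LocalGeometry

open Set
open scoped Topology

lemma hasDerivAt_plane {c : ℝ → Plane} {c' : Plane} {t : ℝ} :
    HasDerivAt c c' t ↔ ∀ i, HasDerivAt (fun s => c s i) (c' i) t := by
  refine ⟨fun h i => (EuclideanSpace.proj i : Plane →L[ℝ] ℝ).hasFDerivAt.comp_hasDerivAt t h,
    fun h => ?_⟩
  exact (PiLp.continuousLinearEquiv 2 ℝ fun _ : Fin 2 => ℝ).symm.hasFDerivAt.comp_hasDerivAt t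
    (hasDerivAt_pi.2 h)

lemma fderiv_eq_partialDeriv (h : Plane → ℝ) (p w : Plane) :
    fderiv ℝ h p w = w 0 * partialDeriv 0 h p + w 1 * partialDeriv 1 h p := by
  conv_lhs => rw [Thermostat.eq_sum_single w]
  simp [partialDeriv]

lemma ContDiff.hasDerivAt_comp_plane {h : Plane → ℝ} (hh : ContDiff ℝ ∞ h) {c : ℝ → Plane}
    {c' : Plane} {t : ℝ} (hc : HasDerivAt c c' t) :
    HasDerivAt (fun s => h (c s))
      (c' 0 * partialDeriv 0 h (c t) + c' 1 * partialDeriv 1 h (c t)) t := by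
  rw [← fderiv_eq_partialDeriv]
  exact (hh.differentiable (by simp) (c t)).hasFDerivAt.comp_hasDerivAt t hc

lemma ContDiff.partialDeriv {h : Plane → ℝ} (hh : ContDiff ℝ ∞ h) (i : Fin 2) :
    ContDiff ℝ ∞ (partialDeriv i h) :=
  (hh.fderiv_right (m := ∞) (by simp)).clm_apply contDiff_const

lemma partialDeriv_comm {h : Plane → ℝ} (hh : ContDiff ℝ ∞ h) (i j : Fin 2) (p : Plane) :
    partialDeriv i (partialDeriv j h) p = partialDeriv j (partialDeriv i h) p := by
  have hd := (hh.fderiv_right (m := ∞) (by simp)).differentiable (by simp) p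
  have key : ∀ i j, partialDeriv i (partialDeriv j h) p = fderiv ℝ (fderiv ℝ h) p
      (EuclideanSpace.single i 1) (EuclideanSpace.single j 1) := fun i j => by
    have := hd.hasFDerivAt.clm_apply (hasFDerivAt_const (EuclideanSpace.single j (1 : ℝ)) p)
    rw [partialDeriv, show partialDeriv j h = fun q => fderiv ℝ h q (EuclideanSpace.single j 1)
      from rfl, this.fderiv]
    simp
  rw [key, key]
  exact (hh.contDiffAt.isSymmSndFDerivAt (by simpa using ENat.LEInfty.out)).eq _ _

lemma partialDeriv_periodic {h : Plane → ℝ} {k : Plane} (hh : ∀ q, h (q + k) = h q) (i : Fin 2)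
    (p : Plane) : partialDeriv i h (p + k) = partialDeriv i h p := by
  rw [partialDeriv, partialDeriv, ← fderiv_comp_add_right]
  simp_rw [hh]

namespace Thermostat

variable (T : Thermostat)

lemma det_gram (p : Plane) : (T.gram p).det = T.gram p 0 0 * T.gram p 1 1 - T.gram p 0 1 ^ 2 := by
  rw [Matrix.det_fin_two, T.gram_symm p 1 0]; ring

lemma gram_zero_zero_pos (p : Plane) : 0 < T.gram p 0 0 :=
  T.metric_pos p (v := EuclideanSpace.single 0 1) (by simp)

lemma det_gram_pos (p : Plane) : 0 < (T.gram p).det := by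
  have h0 := T.gram_zero_zero_pos p
  -- This vector is orthogonal to `∂₀`, and its squared length is `g₀₀ det g`.
  have h := T.metric_pos p (v := !₂[-T.gram p 0 1, T.gram p 0 0]) (fun h => h0.ne' (by
    simpa using congrArg (fun v : Plane => v 1) h))
  rw [metric_eq] at h
  simp only [Matrix.cons_val_zero, Matrix.cons_val_one] at h
  rw [det_gram]
  refine pos_of_mul_pos_right (a := T.gram p 0 0) ?_ h0.le
  linarith

lemma contDiff_det : ContDiff ℝ ∞ (fun p => (T.gram p).det) := by
  simp_rw [det_gram]
  exact ((T.contDiff_gram 0 0).mul (T.contDiff_gram 1 1)).sub ((T.contDiff_gram 0 1).pow 2)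

lemma contDiff_gram_inv (i j : Fin 2) : ContDiff ℝ ∞ (fun p => (T.gram p)⁻¹ i j) := by
  have h : ContDiff ℝ ∞ (fun p => (T.gram p).adjugate i j) := by
    simp_rw [Matrix.adjugate_fin_two]
    fin_cases i <;> fin_cases j
    · exact T.contDiff_gram 1 1
    · exact (T.contDiff_gram 0 1).neg
    · exact (T.contDiff_gram 1 0).neg
    · exact T.contDiff_gram 0 0
  simp_rw [Matrix.inv_def, Matrix.smul_apply, Ring.inverse_eq_inv', smul_eq_mul]
  exact (T.contDiff_det.inv fun p => (T.det_gram_pos p).ne').mul h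

lemma contDiff_christoffel (k i j : Fin 2) : ContDiff ℝ ∞ (T.christoffel k i j) := by
  unfold christoffel
  exact contDiff_const.mul (ContDiff.sum fun l _ => (T.contDiff_gram_inv k l).mul
    ((((T.contDiff_gram j l).partialDeriv i).add ((T.contDiff_gram i l).partialDeriv j)).sub
      ((T.contDiff_gram i j).partialDeriv l)))

lemma christoffel_symm (k i j : Fin 2) (p : Plane) :
    T.christoffel k i j p = T.christoffel k j i p := by
  unfold christoffel
  congr 1
  refine Finset.sum_congr rfl fun l _ => ?_
  rw [show (fun q => T.gram q i j) = fun q => T.gram q j i from funext fun q => T.gram_symm q i j]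
  ring

/-- Lowering the upper index cancels the inverse Gram matrix and leaves the Christoffel symbols of
the first kind. -/
lemma sum_gram_mul_christoffel (l i j : Fin 2) (p : Plane) :
    ∑ k, T.gram p l k * T.christoffel k i j p = 1 / 2 *
      (partialDeriv i (fun q => T.gram q j l) p + partialDeriv j (fun q => T.gram q i l) p
        - partialDeriv l (fun q => T.gram q i j) p) := by
  set S : Fin 2 → ℝ := fun l =>
    partialDeriv i (fun q => T.gram q j l) p + partialDeriv j (fun q => T.gram q i l) p
        - partialDeriv l (fun q => T.gram q i j) p with hS
  have h1 : (fun k => T.christoffel k i j p) = (1 / 2 : ℝ) • ((T.gram p)⁻¹.mulVec S) := by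
    ext k
    simp only [christoffel, hS, Pi.smul_apply, Matrix.mulVec, dotProduct, smul_eq_mul]
  have h2 : (T.gram p).mulVec (fun k => T.christoffel k i j p) = (1 / 2 : ℝ) • S := by
    rw [h1, Matrix.mulVec_smul, Matrix.mulVec_mulVec, Matrix.mul_nonsing_inv _
      (isUnit_iff_ne_zero.2 (T.det_gram_pos p).ne'), Matrix.one_mulVec]
  exact congrFun h2 l

/-- Metric compatibility of the Levi-Civita connection. -/
lemma partialDeriv_gram (i j l : Fin 2) (p : Plane) :
    partialDeriv i (fun q => T.gram q j l) p =
      ∑ m, (T.gram p l m * T.christoffel m i j p + T.gram p j m * T.christoffel m i l p) := by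
  rw [Finset.sum_add_distrib, sum_gram_mul_christoffel, sum_gram_mul_christoffel]
  rw [show (fun q => T.gram q l j) = fun q => T.gram q j l from funext fun q => T.gram_symm q l j]
  ring

/-- The connection matrix in the direction `w`. -/
def conn (p w : Plane) (m j : Fin 2) : ℝ :=
  w 0 * T.christoffel m 0 j p + w 1 * T.christoffel m 1 j p

lemma connection_apply (p u v : Plane) (k : Fin 2) :
    T.connection p u v k = T.conn p u k 0 * v 0 + T.conn p u k 1 * v 1 := by
  simp only [connection, conn, Fin.sum_univ_two]
  ring

lemma connection_symm (p u v : Plane) : T.connection p u v = T.connection p v u := by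
  ext k
  simp only [connection_apply, conn, T.christoffel_symm k 1 0]
  ring

variable {T} in
lemma hasDerivAt_gram {c : ℝ → Plane} {c' : Plane} {t : ℝ} (hc : HasDerivAt c c' t)
    (j l : Fin 2) : HasDerivAt (fun s => T.gram (c s) j l)
      (∑ m, (T.gram (c t) l m * T.conn (c t) c' m j + T.gram (c t) j m * T.conn (c t) c' m l)) t := by
  convert (T.contDiff_gram j l).hasDerivAt_comp_plane hc using 1
  simp only [partialDeriv_gram, Fin.sum_univ_two, conn]
  ring

/-- Covariant differentiation of inner products along curves. -/
lemma hasDerivAt_metric {c A B : ℝ → Plane} {c' A' B' : Plane} {t : ℝ} (hc : HasDerivAt c c' t)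
    (hA : HasDerivAt A A' t) (hB : HasDerivAt B B' t) :
    HasDerivAt (fun s => T.metric (c s) (A s) (B s))
      (T.metric (c t) (A' + T.connection (c t) c' (A t)) (B t)
        + T.metric (c t) (A t) (B' + T.connection (c t) c' (B t))) t := by
  rw [hasDerivAt_plane] at hA hB
  have h00 := hasDerivAt_gram (T := T) hc 0 0
  have h01 := hasDerivAt_gram (T := T) hc 0 1
  have h11 := hasDerivAt_gram (T := T) hc 1 1
  simp_rw [metric_eq]
  refine ((((h00.mul (hA 0)).mul (hB 0)).add
    (h01.mul (((hA 0).mul (hB 1)).add ((hA 1).mul (hB 0))))).add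
    ((h11.mul (hA 1)).mul (hB 1))).congr_deriv ?_
  simp only [PiLp.add_apply, connection_apply, Fin.sum_univ_two, T.gram_symm (c t) 1 0,
    Pi.add_apply, Pi.mul_apply]
  ring

/-- The factor `±1 / √det g` in the definition of the rotation. -/
def rotScale (p : Plane) : ℝ := ((T.orientation : ℤ) : ℝ) / √(T.gram p).det

lemma rot_zero (p v : Plane) :
    T.rot p v 0 = T.rotScale p * -(T.gram p 0 1 * v 0 + T.gram p 1 1 * v 1) := by
  simp [rot, rotScale]

lemma rot_one (p v : Plane) :
    T.rot p v 1 = T.rotScale p * (T.gram p 0 0 * v 0 + T.gram p 0 1 * v 1) := by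
  simp [rot, rotScale]

lemma orientation_sq : (((T.orientation : ℤ) : ℝ)) ^ 2 = 1 := by
  rcases Int.units_eq_one_or T.orientation with h | h <;> simp [h]

/-- The single relation behind `i² = -1`, the isometry property and the orthonormal decomposition
below. -/
lemma rotScale_sq_mul (p : Plane) :
    T.rotScale p ^ 2 * (T.gram p 0 0 * T.gram p 1 1 - T.gram p 0 1 ^ 2) = 1 := by
  rw [← det_gram, rotScale, div_pow, orientation_sq, Real.sq_sqrt (T.det_gram_pos p).le]
  exact one_div_mul_cancel (T.det_gram_pos p).ne'

lemma contDiff_rotScale : ContDiff ℝ ∞ T.rotScale :=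
  contDiff_const.div (T.contDiff_det.sqrt fun p => (T.det_gram_pos p).ne')
    fun p => (Real.sqrt_pos.2 (T.det_gram_pos p)).ne'

/-- By metric compatibility `det g` has logarithmic derivative twice the trace of the connection
matrix; the exponent `-1/2` gives minus the trace. -/
lemma hasDerivAt_rotScale {c : ℝ → Plane} {c' : Plane} {t : ℝ} (hc : HasDerivAt c c' t) :
    HasDerivAt (fun s => T.rotScale (c s))
      (-T.rotScale (c t) * (T.conn (c t) c' 0 0 + T.conn (c t) c' 1 1)) t := by
  have hdet : HasDerivAt (fun s => (T.gram (c s)).det)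
      (2 * (T.conn (c t) c' 0 0 + T.conn (c t) c' 1 1) * (T.gram (c t)).det) t := by
    have h00 := hasDerivAt_gram (T := T) hc 0 0
    have h01 := hasDerivAt_gram (T := T) hc 0 1
    have h11 := hasDerivAt_gram (T := T) hc 1 1
    simp_rw [det_gram]
    refine ((h00.mul h11).sub (h01.pow 2)).congr_deriv ?_
    simp only [Fin.sum_univ_two, T.gram_symm (c t) 1 0]
    ring
  have hpos := T.det_gram_pos (c t)
  have hs := Real.sqrt_pos.2 hpos
  refine ((hasDerivAt_const t (((T.orientation : ℤ) : ℝ))).div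
    (hdet.sqrt hpos.ne') hs.ne').congr_deriv ?_
  rw [rotScale]
  field_simp
  rw [Real.sq_sqrt hpos.le]
  ring

/-- The rotation is parallel. -/
lemma hasDerivAt_rot {c A : ℝ → Plane} {c' A' : Plane} {t : ℝ} (hc : HasDerivAt c c' t)
    (hA : HasDerivAt A A' t) :
    HasDerivAt (fun s => T.rot (c s) (A s))
      (T.rot (c t) (A' + T.connection (c t) c' (A t))
        - T.connection (c t) c' (T.rot (c t) (A t))) t := by
  rw [hasDerivAt_plane] at hA ⊢
  have h00 := hasDerivAt_gram (T := T) hc 0 0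
  have h01 := hasDerivAt_gram (T := T) hc 0 1
  have h11 := hasDerivAt_gram (T := T) hc 1 1
  have hr := T.hasDerivAt_rotScale hc
  intro i
  fin_cases i
  · simp only [Fin.zero_eta, rot_zero]
    refine (hr.mul ((h01.mul (hA 0)).add (h11.mul (hA 1))).neg).congr_deriv ?_
    simp only [PiLp.sub_apply, rot_zero, rot_one, PiLp.add_apply, connection_apply,
      Fin.sum_univ_two, T.gram_symm (c t) 1 0, Pi.add_apply, Pi.mul_apply, Pi.neg_apply]
    ring
  · simp only [Fin.mk_one, rot_one]
    refine (hr.mul ((h00.mul (hA 0)).add (h01.mul (hA 1)))).congr_deriv ?_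
    simp only [PiLp.sub_apply, rot_zero, rot_one, PiLp.add_apply, connection_apply,
      Fin.sum_univ_two, T.gram_symm (c t) 1 0, Pi.add_apply, Pi.mul_apply]
    ring

lemma rot_rot (p v : Plane) : T.rot p (T.rot p v) = -v := by
  have h := T.rotScale_sq_mul p
  ext i
  fin_cases i
  · simp only [Fin.zero_eta, rot_zero, rot_one, PiLp.neg_apply]
    linear_combination -v 0 * h
  · simp only [Fin.mk_one, rot_zero, rot_one, PiLp.neg_apply]
    linear_combination -v 1 * h

lemma metric_rot_rot (p u v : Plane) : T.metric p (T.rot p u) (T.rot p v) = T.metric p u v := by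
  have h := T.rotScale_sq_mul p
  simp only [metric_eq, rot_zero, rot_one]
  linear_combination (T.gram p 0 0 * u 0 * v 0 + T.gram p 0 1 * (u 0 * v 1 + u 1 * v 0) +
      T.gram p 1 1 * u 1 * v 1) * h

lemma metric_add_left (p u u' v : Plane) :
    T.metric p (u + u') v = T.metric p u v + T.metric p u' v := by
  simp only [metric_eq, PiLp.add_apply]; ring

lemma metric_smul_left (p u v : Plane) (a : ℝ) : T.metric p (a • u) v = a * T.metric p u v := by
  simp only [metric_eq, PiLp.smul_apply, smul_eq_mul]; ring

lemma metric_add_right (p u v v' : Plane) :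
    T.metric p u (v + v') = T.metric p u v + T.metric p u v' := by
  simp only [metric_eq, PiLp.add_apply]; ring

lemma metric_smul_right (p u v : Plane) (a : ℝ) : T.metric p u (a • v) = a * T.metric p u v := by
  simp only [metric_eq, PiLp.smul_apply, smul_eq_mul]; ring

lemma metric_rot_self (p u : Plane) : T.metric p u (T.rot p u) = 0 := by
  simp only [metric_eq, rot_zero, rot_one]; ring

lemma metric_rot_left (p u v : Plane) : T.metric p (T.rot p u) v = -T.metric p u (T.rot p v) := by
  simp only [metric_eq, rot_zero, rot_one]; ring

lemma rot_smul (p u : Plane) (a : ℝ) : T.rot p (a • u) = a • T.rot p u := by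
  ext i; fin_cases i <;> simp [rot_zero, rot_one] <;> ring

lemma connection_add_right (p w u v : Plane) :
    T.connection p w (u + v) = T.connection p w u + T.connection p w v := by
  ext i; simp only [connection_apply, PiLp.add_apply]; ring

lemma connection_smul_right (p w u : Plane) (a : ℝ) :
    T.connection p w (a • u) = a • T.connection p w u := by
  ext i; simp only [connection_apply, PiLp.smul_apply, smul_eq_mul]; ring

/-- Decomposition with respect to the orthonormal frame `(v, iv)`. -/
lemma eq_metric_smul_add (p w : Plane) {v : Plane} (hv : T.metric p v v = 1) :
    w = T.metric p w v • v + T.metric p w (T.rot p v) • T.rot p v := by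
  have h := T.rotScale_sq_mul p
  rw [metric_eq] at hv
  ext i
  fin_cases i
  · simp only [Fin.zero_eta, metric_eq, rot_zero, rot_one, PiLp.add_apply, PiLp.smul_apply,
      smul_eq_mul]
    linear_combination (-w 0) * hv - (w 0 * (T.gram p 0 1 * v 0 * v 1 + T.gram p 1 1 * v 1 ^ 2)
      - w 1 * (T.gram p 0 1 * v 0 ^ 2 + T.gram p 1 1 * v 0 * v 1)) * h
  · simp only [Fin.mk_one, metric_eq, rot_zero, rot_one, PiLp.add_apply, PiLp.smul_apply,
      smul_eq_mul]
    linear_combination (-w 1) * hv - (w 1 * (T.gram p 0 0 * v 0 ^ 2 + T.gram p 0 1 * v 0 * v 1)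
      - w 0 * (T.gram p 0 0 * v 0 * v 1 + T.gram p 0 1 * v 1 ^ 2)) * h

end Thermostat

end LocalGeometry

/-! ### Curvature and the linearized spray -/

section Curvature

open Set
open scoped Topology

lemma partialDeriv_add {f g : Plane → ℝ} (hf : ContDiff ℝ ∞ f) (hg : ContDiff ℝ ∞ g) (i : Fin 2)
    (p : Plane) :
    partialDeriv i (fun q => f q + g q) p = partialDeriv i f p + partialDeriv i g p := by
  rw [partialDeriv, fderiv_fun_add (hf.differentiable (by simp) p) (hg.differentiable (by simp) p)]
  rfl

lemma partialDeriv_mul {f g : Plane → ℝ} (hf : ContDiff ℝ ∞ f) (hg : ContDiff ℝ ∞ g) (i : Fin 2)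
    (p : Plane) :
    partialDeriv i (fun q => f q * g q) p
      = partialDeriv i f p * g p + f p * partialDeriv i g p := by
  rw [partialDeriv, fderiv_fun_mul (hf.differentiable (by simp) p) (hg.differentiable (by simp) p)]
  simp only [add_apply, smul_apply, smul_eq_mul, partialDeriv]
  ring

namespace Thermostat

variable (T : Thermostat)

/-- Metric compatibility differentiated once more; antisymmetrizing in `i, j` will produce the
curvature. -/
lemma partialDeriv_partialDeriv_gram (i j k l : Fin 2) (p : Plane) :
    partialDeriv i (partialDeriv j (fun q => T.gram q k l)) p =
      ∑ m, (partialDeriv i (fun q => T.gram q l m) p * T.christoffel m j k p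
        + T.gram p l m * partialDeriv i (T.christoffel m j k) p
        + (partialDeriv i (fun q => T.gram q k m) p * T.christoffel m j l p
        + T.gram p k m * partialDeriv i (T.christoffel m j l) p)) := by
  have hm (m a b : Fin 2) : ContDiff ℝ ∞ fun q => T.gram q a m * T.christoffel m j b q :=
    (T.contDiff_gram a m).mul (T.contDiff_christoffel m j b)
  rw [show partialDeriv j (fun q => T.gram q k l) = _ from
    funext fun q => T.partialDeriv_gram j k l q]
  simp only [Fin.sum_univ_two]
  rw [partialDeriv_add ((hm 0 l k).add (hm 0 k l)) ((hm 1 l k).add (hm 1 k l)),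
    partialDeriv_add (hm 0 l k) (hm 0 k l), partialDeriv_add (hm 1 l k) (hm 1 k l),
    partialDeriv_mul (T.contDiff_gram _ _) (T.contDiff_christoffel _ _ _),
    partialDeriv_mul (T.contDiff_gram _ _) (T.contDiff_christoffel _ _ _),
    partialDeriv_mul (T.contDiff_gram _ _) (T.contDiff_christoffel _ _ _),
    partialDeriv_mul (T.contDiff_gram _ _) (T.contDiff_christoffel _ _ _)]

/-- The curvature `⟨R(∂₀, ∂₁)∂ₖ, ∂ₗ⟩` with all indices lowered. -/
def riemannLow (l k : Fin 2) (p : Plane) : ℝ := ∑ m, T.gram p l m * T.riemann m k 0 1 p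

/-- The curvature operator is skew-symmetric. -/
lemma riemannLow_skew (l k : Fin 2) (p : Plane) :
    T.riemannLow l k p = -T.riemannLow k l p := by
  -- Commuting mixed partials of `g_{kl}` is the whole content: their difference is the symmetric
  -- part of the lowered curvature.
  have h := partialDeriv_comm (T.contDiff_gram k l) 0 1 p
  rw [partialDeriv_partialDeriv_gram, partialDeriv_partialDeriv_gram] at h
  simp only [partialDeriv_gram, Fin.sum_univ_two] at h
  simp only [riemannLow, riemann, Fin.sum_univ_two]
  simp only [T.gram_symm p 1 0, T.gram_symm p l 0, T.gram_symm p l 1, T.gram_symm p k 0,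
    T.gram_symm p k 1] at h ⊢
  linear_combination h

lemma gaussCurvature_eq (p : Plane) :
    T.gaussCurvature p = T.riemannLow 0 1 p / (T.gram p).det := rfl

/-- The derivative of the Christoffel symbols in the direction `w`, contracted with `a`, `b`. -/
def dconn (p w a b : Plane) : Plane :=
  WithLp.toLp 2 fun k => ∑ i, ∑ j,
    (w 0 * partialDeriv 0 (T.christoffel k i j) p + w 1 * partialDeriv 1 (T.christoffel k i j) p)
      * a i * b j

lemma hasDerivAt_connection {c A B : ℝ → Plane} {c' A' B' : Plane} {t : ℝ}
    (hc : HasDerivAt c c' t) (hA : HasDerivAt A A' t) (hB : HasDerivAt B B' t) :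
    HasDerivAt (fun s => T.connection (c s) (A s) (B s))
      (T.connection (c t) A' (B t) + T.connection (c t) (A t) B'
        + T.dconn (c t) c' (A t) (B t)) t := by
  rw [hasDerivAt_plane] at hA hB ⊢
  intro k
  have h (i j : Fin 2) := ((((T.contDiff_christoffel k i j).hasDerivAt_comp_plane hc).mul
    (hA i)).mul (hB j))
  refine (((h 0 0).add (h 0 1)).add ((h 1 0).add (h 1 1))).congr_of_eventuallyEq
    (Filter.Eventually.of_forall fun s => ?_) |>.congr_deriv ?_
  · simp [connection, Fin.sum_univ_two]
  · simp only [PiLp.add_apply, connection_apply, conn, dconn, Fin.sum_univ_two, Pi.mul_apply]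
    ring

/-- The curvature vector `R(v, J)v`, in coordinates. -/
def curv (p v J : Plane) : Plane :=
  T.dconn p v v J - T.dconn p J v v + T.connection p v (T.connection p v J)
    - T.connection p J (T.connection p v v)

/-- Antisymmetry of `R` in its first two arguments reduces it, in dimension two, to `v ∧ J` times
`R(∂₀, ∂₁)`. -/
lemma curv_apply (p v J : Plane) (l : Fin 2) : T.curv p v J l =
    (v 0 * J 1 - v 1 * J 0) * (T.riemann l 0 0 1 p * v 0 + T.riemann l 1 0 1 p * v 1) := by
  have e : T.christoffel l 1 0 = T.christoffel l 0 1 := funext fun q => T.christoffel_symm l 1 0 q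
  simp only [curv, dconn, riemann, PiLp.add_apply, PiLp.sub_apply, connection_apply, conn,
    Fin.sum_univ_two, e, T.christoffel_symm _ 1 0 p]
  ring

lemma metric_rot_eq (p u v : Plane) : T.metric p u (T.rot p v) =
    T.rotScale p * (T.gram p).det * (v 0 * u 1 - v 1 * u 0) := by
  simp only [metric_eq, rot_zero, rot_one, det_gram]
  ring

/-- Skew-symmetry of `R(∂₀, ∂₁)` leaves one independent component, multiplied by two determinants.
-/
lemma metric_curv (p v J w : Plane) : T.metric p (T.curv p v J) w =
    (v 0 * J 1 - v 1 * J 0) * T.riemannLow 0 1 p * (v 1 * w 0 - v 0 * w 1) := by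
  have h00 : T.riemannLow 0 0 p = 0 := by linarith [T.riemannLow_skew 0 0 p]
  have h11 : T.riemannLow 1 1 p = 0 := by linarith [T.riemannLow_skew 1 1 p]
  have h10 := T.riemannLow_skew 1 0 p
  have key : T.metric p (T.curv p v J) w = (v 0 * J 1 - v 1 * J 0) *
      ((T.riemannLow 0 0 p * v 0 + T.riemannLow 0 1 p * v 1) * w 0
        + (T.riemannLow 1 0 p * v 0 + T.riemannLow 1 1 p * v 1) * w 1) := by
    simp only [metric_eq, curv_apply, riemannLow, Fin.sum_univ_two, T.gram_symm p 1 0]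
    ring
  rw [key, h00, h11, h10]
  ring

lemma metric_curv_self (p v J : Plane) : T.metric p (T.curv p v J) v = 0 := by
  rw [metric_curv]; ring

lemma metric_curv_rot (p v J : Plane) : T.metric p (T.curv p v J) (T.rot p v) =
    -T.gaussCurvature p * T.metric p v v * T.metric p J (T.rot p v) := by
  rw [metric_curv, metric_rot_eq, gaussCurvature_eq, rot_zero, rot_one, metric_eq]
  have := (T.det_gram_pos p).ne'
  field_simp
  ring

lemma contDiff_rot : ContDiff ℝ ∞ (fun q : Plane × Plane => T.rot q.1 q.2) := by
  have hv (i : Fin 2) : ContDiff ℝ ∞ (fun q : Plane × Plane => q.2 i) :=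
    (EuclideanSpace.proj i : Plane →L[ℝ] ℝ).contDiff.comp contDiff_snd
  have hg (i j : Fin 2) : ContDiff ℝ ∞ (fun q : Plane × Plane => T.gram q.1 i j) :=
    (T.contDiff_gram i j).comp contDiff_fst
  have hr : ContDiff ℝ ∞ (fun q : Plane × Plane => T.rotScale q.1) :=
    T.contDiff_rotScale.comp contDiff_fst
  rw [contDiff_euclidean]
  intro i
  fin_cases i
  · simp only [Fin.zero_eta, rot_zero]
    exact hr.mul (((hg 0 1).mul (hv 0)).add ((hg 1 1).mul (hv 1))).neg
  · simp only [Fin.mk_one, rot_one]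
    exact hr.mul (((hg 0 0).mul (hv 0)).add ((hg 0 1).mul (hv 1)))

lemma contDiff_lam : ContDiff ℝ ∞ (fun q : Plane × Plane => T.lam q.1 q.2) := by
  have hr := contDiff_euclidean.1 T.contDiff_rot
  simp_rw [lam_eq]
  exact (T.contDiff_magnetic.comp contDiff_fst).add
    ((((T.contDiff_field 0).comp contDiff_fst).mul (hr 0)).add
      (((T.contDiff_field 1).comp contDiff_fst).mul (hr 1)))

lemma contDiff_connection : ContDiff ℝ ∞ (fun q : Plane × Plane => T.connection q.1 q.2 q.2) := by
  have hv (i : Fin 2) : ContDiff ℝ ∞ (fun q : Plane × Plane => q.2 i) :=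
    (EuclideanSpace.proj i : Plane →L[ℝ] ℝ).contDiff.comp contDiff_snd
  rw [contDiff_euclidean]
  intro k
  simp only [connection]
  exact ContDiff.sum fun i _ => ContDiff.sum fun j _ =>
    (((T.contDiff_christoffel k i j).comp contDiff_fst).mul (hv i)).mul (hv j)

lemma contDiff_metric : ContDiff ℝ ∞ (fun q : Plane × Plane => T.metric q.1 q.2 q.2) := by
  have hv (i : Fin 2) : ContDiff ℝ ∞ (fun q : Plane × Plane => q.2 i) :=
    (EuclideanSpace.proj i : Plane →L[ℝ] ℝ).contDiff.comp contDiff_snd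
  have hg (i j : Fin 2) : ContDiff ℝ ∞ (fun q : Plane × Plane => T.gram q.1 i j) :=
    (T.contDiff_gram i j).comp contDiff_fst
  simp_rw [metric_eq]
  exact ((((hg 0 0).mul (hv 0)).mul (hv 0)).add ((hg 0 1).mul
    (((hv 0).mul (hv 1)).add ((hv 1).mul (hv 0))))).add (((hg 1 1).mul (hv 1)).mul (hv 1))

/-- The acceleration of a thermostat geodesic, in coordinates. -/
def accel (p v : Plane) : Plane := T.lam p v • T.rot p v - T.connection p v v

/-- The vector field on the plane times the plane whose integral curves of unit energy are the
velocity curves of the thermostat geodesics. -/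
def spray (q : Plane × Plane) : Plane × Plane := (q.2, T.accel q.1 q.2)

lemma contDiff_spray : ContDiff ℝ ∞ T.spray :=
  contDiff_snd.prodMk ((T.contDiff_lam.smul T.contDiff_rot).sub T.contDiff_connection)

/-- The derivative of `λ` on the phase space. -/
def dlam (p v J Q : Plane) : ℝ := fderiv ℝ (fun q : Plane × Plane => T.lam q.1 q.2) (p, v) (J, Q)

lemma hasDerivAt_lam {c A : ℝ → Plane} {c' A' : Plane} {t : ℝ} (hc : HasDerivAt c c' t)
    (hA : HasDerivAt A A' t) :
    HasDerivAt (fun s => T.lam (c s) (A s)) (T.dlam (c t) (A t) c' A') t :=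
  HasFDerivAt.comp_hasDerivAt (f := fun s => (c s, A s)) t
    (T.contDiff_lam.differentiable (by simp) _).hasFDerivAt (hc.prodMk hA)

/-- The linearization of the spray. -/
def dspray (p v J Q : Plane) : Plane :=
  T.dlam p v J Q • T.rot p v
    + T.lam p v • (T.rot p (Q + T.connection p J v) - T.connection p J (T.rot p v))
    - (T.connection p Q v + T.connection p v Q + T.dconn p J v v)

/-- Differentiation along the line `s ↦ (p + sJ, v + sQ)` lets the formulas for derivatives along
curves, including parallelism of the rotation, do the work. -/
lemma fderiv_spray (p v J Q : Plane) :
    fderiv ℝ T.spray (p, v) (J, Q) = (Q, T.dspray p v J Q) := by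
  have hc : HasDerivAt (fun s : ℝ => p + s • J) J 0 := by
    simpa using ((hasDerivAt_id (0 : ℝ)).smul_const J).const_add p
  have hA : HasDerivAt (fun s : ℝ => v + s • Q) Q 0 := by
    simpa using ((hasDerivAt_id (0 : ℝ)).smul_const Q).const_add v
  have h1 : HasDerivAt (fun s : ℝ => T.spray (p + s • J, v + s • Q))
      (fderiv ℝ T.spray (p, v) (J, Q)) 0 := by
    have hd := (T.contDiff_spray.differentiable (by simp) (p, v)).hasFDerivAt
    refine HasFDerivAt.comp_hasDerivAt (l := T.spray) (f := fun s : ℝ => (p + s • J, v + s • Q)) 0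
      ?_ (hc.prodMk hA)
    simpa using hd
  have h2 := hA.prodMk (((T.hasDerivAt_lam hc hA).smul (T.hasDerivAt_rot hc hA)).sub
    (T.hasDerivAt_connection hc hA hA))
  refine (h1.unique h2).trans ?_
  simp only [zero_smul, add_zero, dspray]
  congr 2
  abel

end Thermostat

end Curvature

/-! ### From variation fields to the Jacobi equation -/

section Jacobi

open Set
open scoped Topology

lemma contDiff_two_of_hasDerivAt {E : Type*} [NormedAddCommGroup E] [NormedSpace ℝ E]
    {y y₁ y₂ : ℝ → E} (h : ∀ t, HasDerivAt y (y₁ t) t)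
    (h₁ : ∀ t, HasDerivAt y₁ (y₂ t) t) (h₂ : Continuous y₂) : ContDiff ℝ 2 y := by
  have e : deriv y = y₁ := funext fun t => (h t).deriv
  have e₁ : deriv y₁ = y₂ := funext fun t => (h₁ t).deriv
  rw [show (2 : WithTop ℕ∞) = 1 + 1 by norm_num, contDiff_succ_iff_deriv, e, contDiff_one_iff_deriv,
    e₁]
  exact ⟨fun t => (h t).differentiableAt, by simp, fun t => (h₁ t).differentiableAt, h₂⟩

namespace Thermostat

variable (T : Thermostat)

lemma Vlam_eq (p v : Plane) : T.Vlam p v = T.dlam p v 0 (T.rot p v) := by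
  have hA : HasDerivAt (fun θ : ℝ => Real.cos θ • v + Real.sin θ • T.rot p v) (T.rot p v) 0 := by
    refine (((Real.hasDerivAt_cos 0).smul_const v).add
      ((Real.hasDerivAt_sin 0).smul_const (T.rot p v))).congr_deriv ?_
    simp
  refine (T.hasDerivAt_lam (hasDerivAt_const 0 p) hA).deriv.trans ?_
  simp

lemma Hlam_eq (p v : Plane) :
    T.Hlam p v = T.dlam p v (T.rot p v) (-T.connection p (T.rot p v) v) := rfl

lemma dlam_add (p v J J' Q Q' : Plane) :
    T.dlam p v (J + J') (Q + Q') = T.dlam p v J Q + T.dlam p v J' Q' := by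
  rw [dlam, ← Prod.mk_add_mk, map_add]; rfl

lemma dlam_smul (p v J Q : Plane) (a : ℝ) : T.dlam p v (a • J) (a • Q) = a * T.dlam p v J Q := by
  rw [dlam, ← Prod.smul_mk, map_smul]; rfl

variable {T} in
lemma continuous_dlam {X : Type*} [TopologicalSpace X] {c v J Q : X → Plane} (hc : Continuous c)
    (hv : Continuous v) (hJ : Continuous J) (hQ : Continuous Q) :
    Continuous fun t => T.dlam (c t) (v t) (J t) (Q t) :=
  ((T.contDiff_lam.continuous_fderiv (by simp)).comp (hc.prodMk hv)).clm_apply (hJ.prodMk hQ)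

variable {T} in
lemma continuous_rot {X : Type*} [TopologicalSpace X] {c v : X → Plane} (hc : Continuous c)
    (hv : Continuous v) : Continuous fun t => T.rot (c t) (v t) := by
  have := T.contDiff_rot.continuous.comp' (hc.prodMk hv)
  exact this

variable {T} in
lemma continuous_conn {X : Type*} [TopologicalSpace X] {c u v : X → Plane} (hc : Continuous c)
    (hu : Continuous u) (hv : Continuous v) : Continuous fun t => T.connection (c t) (u t) (v t) := by
  have hΓ (k i j : Fin 2) : Continuous fun t => T.christoffel k i j (c t) :=
    (T.contDiff_christoffel k i j).continuous.comp hc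
  unfold connection
  fun_prop

lemma continuous_gaussCurvature : Continuous T.gaussCurvature := by
  have hΓ (k i j : Fin 2) := (T.contDiff_christoffel k i j).continuous
  have hdΓ (l k i j : Fin 2) := ((T.contDiff_christoffel k i j).partialDeriv l).continuous
  have hg (i j : Fin 2) := (T.contDiff_gram i j).continuous
  refine Continuous.div ?_ T.contDiff_det.continuous fun p => (T.det_gram_pos p).ne'
  unfold riemann
  fun_prop

/-- Continuity is what uniqueness for the Jacobi equation requires. -/
lemma continuous_jacobi_coefficients {c v : ℝ → Plane} (hc : Continuous c) (hv : Continuous v) :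
    Continuous (fun t => T.Vlam (c t) (v t)) ∧
    Continuous (fun t => T.gaussCurvature (c t) - T.Hlam (c t) (v t) + T.lam (c t) (v t) ^ 2) := by
  have hr := continuous_rot (T := T) hc hv
  refine ⟨?_, ?_⟩
  · simp_rw [Vlam_eq]
    exact continuous_dlam hc hv continuous_const hr
  · simp_rw [Hlam_eq]
    exact ((T.continuous_gaussCurvature.comp hc).sub
      (continuous_dlam hc hv hr (continuous_conn hc hr hv).neg)).add
      ((T.contDiff_lam.continuous.comp (hc.prodMk hv)).pow 2)

/-- Solutions `(J, Q)` of the linearization of the geodesic equation along a unit speed geodesic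
`c` with velocity `v`, such that the covariant derivative of `J` is normal to `v` at time `0`. -/
structure IsVariation (c v J Q : ℝ → Plane) : Prop where
  hasDerivAt_curve : ∀ t, HasDerivAt c (v t) t
  hasDerivAt_velocity : ∀ t, HasDerivAt v (T.accel (c t) (v t)) t
  hasDerivAt_field : ∀ t, HasDerivAt J (Q t) t
  hasDerivAt_field' : ∀ t, HasDerivAt Q (T.dspray (c t) (v t) (J t) (Q t)) t
  unit : ∀ t, T.metric (c t) (v t) (v t) = 1
  normal : T.metric (c 0) (Q 0 + T.connection (c 0) (v 0) (J 0)) (v 0) = 0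

namespace IsVariation

variable {T} {c v J Q : ℝ → Plane} (h : T.IsVariation c v J Q)
include h

/-- The linearized equation in covariant form: `D_t D_t J = dλ(J, Q) iv + λ i D_t J + R(v, J)v`, the
curvature arising from exchanging covariant derivatives. -/
lemma hasDerivAt_covariant (t : ℝ) :
    HasDerivAt (fun s => Q s + T.connection (c s) (v s) (J s))
      (T.dlam (c t) (v t) (J t) (Q t) • T.rot (c t) (v t)
        + T.lam (c t) (v t) • T.rot (c t) (Q t + T.connection (c t) (v t) (J t))
        + T.curv (c t) (v t) (J t)
        - T.connection (c t) (v t) (Q t + T.connection (c t) (v t) (J t))) t := by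
  refine ((h.hasDerivAt_field' t).add (T.hasDerivAt_connection (h.hasDerivAt_curve t)
    (h.hasDerivAt_velocity t) (h.hasDerivAt_field t))).congr_deriv ?_
  have e1 : T.connection (c t) (T.accel (c t) (v t)) (J t)
      = T.lam (c t) (v t) • T.connection (c t) (J t) (T.rot (c t) (v t))
        - T.connection (c t) (J t) (T.connection (c t) (v t) (v t)) := by
    rw [T.connection_symm, accel, sub_eq_add_neg, connection_add_right, connection_smul_right,
      ← neg_one_smul ℝ (T.connection (c t) (v t) (v t)), connection_smul_right, neg_one_smul,
      ← sub_eq_add_neg]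
  rw [e1, dspray, curv, T.connection_symm (c t) (Q t) (v t), T.connection_symm (c t) (J t) (v t),
    connection_add_right]
  module

/-- The covariant derivative of the variation field stays normal to the velocity. -/
lemma metric_covariant_eq_zero (t : ℝ) :
    T.metric (c t) (Q t + T.connection (c t) (v t) (J t)) (v t) = 0 := by
  have hd : ∀ t, HasDerivAt
      (fun s => T.metric (c s) (Q s + T.connection (c s) (v s) (J s)) (v s)) 0 t := fun t => by
    refine (T.hasDerivAt_metric (h.hasDerivAt_curve t) (h.hasDerivAt_covariant t)
      (h.hasDerivAt_velocity t)).congr_deriv ?_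
    -- The `dλ` and curvature terms are normal to `v`, and the two `λ` terms cancel because the
    -- rotation is skew.
    rw [sub_add_cancel, accel, sub_add_cancel, metric_add_left, metric_add_left, metric_smul_left,
      metric_smul_left, metric_smul_right, metric_curv_self, metric_rot_left, metric_rot_left,
      metric_rot_self]
    ring
  have := is_const_of_deriv_eq_zero (fun t => (hd t).differentiableAt) (fun t => (hd t).deriv) t 0
  exact this.trans h.normal

/-- Only the turning of `v`, namely `D_t v = λ iv`, contributes, since `D_t J` is normal to `v`. -/
lemma hasDerivAt_tangential (t : ℝ) : HasDerivAt (fun s => T.metric (c s) (J s) (v s))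
    (T.lam (c t) (v t) * T.metric (c t) (J t) (T.rot (c t) (v t))) t := by
  refine (T.hasDerivAt_metric (h.hasDerivAt_curve t) (h.hasDerivAt_field t)
    (h.hasDerivAt_velocity t)).congr_deriv ?_
  rw [h.metric_covariant_eq_zero, accel, sub_add_cancel, metric_smul_right, zero_add]

lemma hasDerivAt_rot_velocity (t : ℝ) : HasDerivAt (fun s => T.rot (c s) (v s))
    (-(T.lam (c t) (v t) • v t) - T.connection (c t) (v t) (T.rot (c t) (v t))) t := by
  refine (T.hasDerivAt_rot (h.hasDerivAt_curve t) (h.hasDerivAt_velocity t)).congr_deriv ?_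
  rw [accel, sub_add_cancel, rot_smul, rot_rot, smul_neg]

lemma hasDerivAt_normal (t : ℝ) :
    HasDerivAt (fun s => T.metric (c s) (J s) (T.rot (c s) (v s)))
      (T.metric (c t) (Q t + T.connection (c t) (v t) (J t)) (T.rot (c t) (v t))
        - T.lam (c t) (v t) * T.metric (c t) (J t) (v t)) t := by
  refine (T.hasDerivAt_metric (h.hasDerivAt_curve t) (h.hasDerivAt_field t)
    (h.hasDerivAt_rot_velocity t)).congr_deriv ?_
  rw [sub_add_cancel, ← neg_smul, metric_smul_right]
  ring

/-- Pairing the covariant equation with `iv` leaves `dλ` and the curvature; the `λ` terms drop out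
because `D_t J` has no tangential part. -/
lemma hasDerivAt_vertical (t : ℝ) :
    HasDerivAt (fun s => T.metric (c s) (Q s + T.connection (c s) (v s) (J s)) (T.rot (c s) (v s)))
      (T.dlam (c t) (v t) (J t) (Q t)
        - T.gaussCurvature (c t) * T.metric (c t) (J t) (T.rot (c t) (v t))) t := by
  refine (T.hasDerivAt_metric (h.hasDerivAt_curve t) (h.hasDerivAt_covariant t)
    (h.hasDerivAt_rot_velocity t)).congr_deriv ?_
  rw [sub_add_cancel, sub_add_cancel, ← neg_smul, metric_smul_right, h.metric_covariant_eq_zero,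
    metric_add_left, metric_add_left, metric_smul_left, metric_smul_left, metric_rot_rot,
    metric_rot_rot, h.metric_covariant_eq_zero, metric_curv_rot, h.unit]
  ring

/-- Expands `(J, Q)` in the frame of the flow generator `(v, accel)`, `H` and `V`. The coefficient
of `V` is exactly the derivative of the normal component. -/
lemma dlam_eq (t : ℝ) : T.dlam (c t) (v t) (J t) (Q t) =
    T.metric (c t) (J t) (v t) * T.dlam (c t) (v t) (v t) (T.accel (c t) (v t))
    + T.metric (c t) (J t) (T.rot (c t) (v t)) * T.Hlam (c t) (v t)
    + (T.metric (c t) (Q t + T.connection (c t) (v t) (J t)) (T.rot (c t) (v t))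
        - T.lam (c t) (v t) * T.metric (c t) (J t) (v t)) * T.Vlam (c t) (v t) := by
  have e1 := T.eq_metric_smul_add (c t) (J t) (h.unit t)
  have e2 := T.eq_metric_smul_add (c t) (Q t + T.connection (c t) (v t) (J t)) (h.unit t)
  rw [h.metric_covariant_eq_zero, zero_smul, zero_add] at e2
  set x := T.metric (c t) (J t) (v t)
  set y := T.metric (c t) (J t) (T.rot (c t) (v t))
  set u := T.metric (c t) (Q t + T.connection (c t) (v t) (J t)) (T.rot (c t) (v t))
  have e3 : Q t = x • T.accel (c t) (v t)
      + y • -T.connection (c t) (T.rot (c t) (v t)) (v t)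
      + (u - T.lam (c t) (v t) * x) • T.rot (c t) (v t) := by
    rw [e1, connection_add_right, connection_smul_right, connection_smul_right] at e2
    rw [eq_sub_of_add_eq e2, accel, T.connection_symm (c t) (T.rot (c t) (v t)) (v t)]
    module
  have e4 : J t = x • v t + y • T.rot (c t) (v t) + (u - T.lam (c t) (v t) * x) • (0 : Plane) := by
    rw [smul_zero, add_zero]; exact e1
  rw [Hlam_eq, Vlam_eq, ← dlam_smul, ← dlam_smul, ← dlam_smul, ← dlam_add, ← dlam_add, ← e3, ← e4]

/-- The normal component of a variation field solves the Jacobi equation. -/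
theorem isJacobiSolution :
    T.IsJacobiSolution c (fun t => T.metric (c t) (J t) (T.rot (c t) (v t))) := by
  have hcont_c : Continuous c :=
    continuous_iff_continuousAt.2 fun t => (h.hasDerivAt_curve t).continuousAt
  have hcont_v : Continuous v :=
    continuous_iff_continuousAt.2 fun t => (h.hasDerivAt_velocity t).continuousAt
  have ec : deriv c = v := funext fun t => (h.hasDerivAt_curve t).deriv
  obtain ⟨hV, hκ⟩ := T.continuous_jacobi_coefficients hcont_c hcont_v
  set y := fun t => T.metric (c t) (J t) (T.rot (c t) (v t)) with hy
  set y₁ := fun t => T.metric (c t) (Q t + T.connection (c t) (v t) (J t)) (T.rot (c t) (v t))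
    - T.lam (c t) (v t) * T.metric (c t) (J t) (v t) with hy₁
  have hd : ∀ t, HasDerivAt y (y₁ t) t := h.hasDerivAt_normal
  have hd₁ : ∀ t, HasDerivAt y₁ (T.Vlam (c t) (v t) * y₁ t
      - (T.gaussCurvature (c t) - T.Hlam (c t) (v t) + T.lam (c t) (v t) ^ 2) * y t) t := fun t => by
    refine ((h.hasDerivAt_vertical t).sub ((T.hasDerivAt_lam (h.hasDerivAt_curve t)
      (h.hasDerivAt_velocity t)).mul (h.hasDerivAt_tangential t))).congr_deriv ?_
    -- The derivative of `λ` along the flow, multiplied by the tangential component, occurs twice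
    -- with opposite signs and disappears.
    rw [h.dlam_eq]
    simp only [hy, hy₁]
    ring
  have hcy : Continuous y := continuous_iff_continuousAt.2 fun t => (hd t).continuousAt
  have hcy₁ : Continuous y₁ := continuous_iff_continuousAt.2 fun t => (hd₁ t).continuousAt
  refine ⟨contDiff_two_of_hasDerivAt hd hd₁ ((hV.mul hcy₁).sub (hκ.mul hcy)), fun t => ?_⟩
  rw [show deriv y = y₁ from funext fun t => (hd t).deriv, (hd₁ t).deriv, ec]
  ring

end IsVariation

end Thermostat

end Jacobi

/-! ### The complete thermostat flow and its variation fields -/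

section Flow

open Set
open scoped Topology

lemma norm_plane_le (v : Plane) : ‖v‖ ≤ |v 0| + |v 1| := by
  conv_lhs => rw [Thermostat.eq_sum_single v]
  refine (norm_add_le _ _).trans ?_
  simp [norm_smul]

lemma exists_deck_translation (p : Plane) :
    ∃ k : Plane, torusCover k = 1 ∧ ‖p + k‖ ≤ 4 * Real.pi := by
  have hpi := Real.pi_pos
  have key (a : ℝ) : |a + -⌊a / (2 * Real.pi)⌋ * (2 * Real.pi)| ≤ 2 * Real.pi := by
    have h : a + -⌊a / (2 * Real.pi)⌋ * (2 * Real.pi)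
        = Int.fract (a / (2 * Real.pi)) * (2 * Real.pi) := by
      rw [Int.fract]; field_simp; ring
    rw [h, abs_of_nonneg (mul_nonneg (Int.fract_nonneg _) (by positivity))]
    exact mul_le_of_le_one_left (by positivity) (Int.fract_lt_one _).le
  refine ⟨!₂[-⌊p 0 / (2 * Real.pi)⌋ * (2 * Real.pi), -⌊p 1 / (2 * Real.pi)⌋ * (2 * Real.pi)],
    ?_, ?_⟩
  · have h (n : ℤ) : Circle.exp (-n * (2 * Real.pi)) = 1 := by
      exact_mod_cast Circle.exp_int_mul_two_pi (-n)
    exact Prod.ext (h _) (h _)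
  · refine (norm_plane_le _).trans ?_
    have h0 := key (p 0)
    have h1 := key (p 1)
    simp only [PiLp.add_apply, Matrix.cons_val_zero, Matrix.cons_val_one]
    linarith

namespace Thermostat

variable (T : Thermostat)

variable {T} in
lemma christoffel_periodic {k : Plane} (hk : torusCover k = 1) (m i j : Fin 2) (p : Plane) :
    T.christoffel m i j (p + k) = T.christoffel m i j p := by
  have h (i j l : Fin 2) : partialDeriv l (fun q => T.gram q i j) (p + k)
      = partialDeriv l (fun q => T.gram q i j) p :=
    partialDeriv_periodic (fun q => by rw [gram_periodic hk]) l p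
  simp only [christoffel, gram_periodic hk, h]

variable {T} in
lemma metric_periodic {k : Plane} (hk : torusCover k = 1) (p u v : Plane) :
    T.metric (p + k) u v = T.metric p u v := by
  simp only [metric_eq, gram_periodic hk]

variable {T} in
-- The spray descends to the torus, so bounds over a compact set of base points hold everywhere.
lemma spray_periodic {k : Plane} (hk : torusCover k = 1) (p v : Plane) :
    T.spray (p + k, v) = T.spray (p, v) := by
  have hr : T.rot (p + k) v = T.rot p v := by simp only [rot, gram_periodic hk]
  simp only [spray, accel, lam_eq, hr, connection, christoffel_periodic hk, field_periodic hk,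
    torusCover_add p k hk]

/-- The metric is uniformly elliptic on compact sets. -/
lemma exists_mul_sq_le_metric (R : ℝ) :
    ∃ m : ℝ, 0 < m ∧ ∀ p : Plane, ‖p‖ ≤ R → ∀ v : Plane, m * ‖v‖ ^ 2 ≤ T.metric p v v := by
  rcases lt_or_ge R 0 with hR | hR
  · exact ⟨1, one_pos, fun p hp => absurd (hp.trans_lt hR) (norm_nonneg p).not_gt⟩
  obtain ⟨⟨p₀, v₀⟩, hmem, hmin⟩ := ((isCompact_closedBall (0 : Plane) R).prod
    (isCompact_sphere (0 : Plane) 1)).exists_isMinOn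
    ⟨(0, EuclideanSpace.single 0 1), by simp [hR]⟩ T.contDiff_metric.continuous.continuousOn
  have hv₀ : v₀ ≠ 0 := by
    rintro rfl
    simpa using hmem.2
  refine ⟨_, T.metric_pos p₀ hv₀, fun p hp v => ?_⟩
  rcases eq_or_ne v 0 with rfl | hv
  · simp [metric_eq]
  have hn : ‖v‖ ≠ 0 := norm_ne_zero_iff.2 hv
  have h := hmin (show (p, ‖v‖⁻¹ • v) ∈ _ from ⟨by simpa using hp, by simp [norm_smul, hn]⟩)
  have h' : T.metric p₀ v₀ v₀ ≤ T.metric p (‖v‖⁻¹ • v) (‖v‖⁻¹ • v) := h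
  rw [metric_smul_left, metric_smul_right] at h'
  calc T.metric p₀ v₀ v₀ * ‖v‖ ^ 2 ≤ (‖v‖⁻¹ * (‖v‖⁻¹ * T.metric p v v)) * ‖v‖ ^ 2 := by gcongr
    _ = T.metric p v v := by field_simp

/-- A cutoff function around energy `1`. -/
def energyBump : ContDiffBump (1 : ℝ) := ⟨1 / 2, 1, by norm_num, by norm_num⟩

/-- The spray, cut off away from the unit circle bundle. -/
def cutSpray (q : Plane × Plane) : Plane × Plane :=
  energyBump (T.metric q.1 q.2 q.2) • T.spray q

lemma contDiff_cutSpray : ContDiff ℝ ∞ T.cutSpray :=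
  (energyBump.contDiff.comp T.contDiff_metric).smul T.contDiff_spray

/-- Periodicity confines the base point to a ball, and the cutoff vanishes at energy at least `2`,
which by ellipticity confines the velocity to `‖v‖ ≤ √(2 / m)`. -/
lemma cutSpray_bounded : ∃ M : ℝ, ∀ q, ‖T.cutSpray q‖ ≤ M := by
  obtain ⟨m, hm0, hm⟩ := T.exists_mul_sq_le_metric (4 * Real.pi)
  obtain ⟨M, hM⟩ := ((isCompact_closedBall (0 : Plane) (4 * Real.pi)).prod
    (isCompact_closedBall (0 : Plane) √(2 / m))).exists_bound_of_continuousOn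
    T.contDiff_cutSpray.continuous.continuousOn
  refine ⟨max M 0, fun ⟨p, v⟩ => ?_⟩
  obtain ⟨k, hk, hpk⟩ := exists_deck_translation p
  have hper : T.cutSpray (p, v) = T.cutSpray (p + k, v) := by
    simp only [cutSpray, metric_periodic hk, spray_periodic hk]
  rw [hper]
  by_cases hv : ‖v‖ ≤ √(2 / m)
  · exact (hM (p + k, v) ⟨by simpa using hpk, by simpa using hv⟩).trans (le_max_left _ _)
  · have h2 : 2 < T.metric (p + k) v v := by
      refine lt_of_lt_of_le ?_ (hm _ hpk v)
      have := (Real.sqrt_lt' (by linarith [Real.sqrt_nonneg (2 / m)] : 0 < ‖v‖)).1 (not_le.1 hv)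
      rwa [div_lt_iff₀' hm0] at this
    have h0 : energyBump (T.metric (p + k) v v) = 0 := by
      refine energyBump.zero_of_le_dist ?_
      rw [Real.dist_eq, abs_of_pos (by linarith)]
      change (1 : ℝ) ≤ _
      linarith
    simp [cutSpray, h0]

/-- The flow of the cut off spray. On the unit circle bundle, it is the thermostat flow. -/
def flow : ℝ → Plane × Plane → Plane × Plane :=
  (exists_flow_of_bounded T.contDiff_cutSpray T.cutSpray_bounded.choose_spec).choose

lemma flow_zero (x : Plane × Plane) : T.flow 0 x = x :=
  (exists_flow_of_bounded T.contDiff_cutSpray T.cutSpray_bounded.choose_spec).choose_spec.1 x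

lemma hasDerivAt_flow_cutSpray (t : ℝ) (x : Plane × Plane) :
    HasDerivAt (fun s => T.flow s x) (T.cutSpray (T.flow t x)) t :=
  (exists_flow_of_bounded T.contDiff_cutSpray T.cutSpray_bounded.choose_spec).choose_spec.2 t x

lemma contDiff_flow : ContDiff ℝ ∞ (fun z : ℝ × Plane × Plane => T.flow z.1 z.2) :=
  _root_.contDiff_flow T.contDiff_cutSpray T.flow_zero T.hasDerivAt_flow_cutSpray

/-- The cutoff only rescales the spray, so the covariant acceleration is still a multiple of `iv`
and energy is conserved. -/
lemma metric_flow (t : ℝ) (x : Plane × Plane) :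
    T.metric (T.flow t x).1 (T.flow t x).2 (T.flow t x).2 = T.metric x.1 x.2 x.2 := by
  have hd : ∀ t, HasDerivAt (fun s => T.metric (T.flow s x).1 (T.flow s x).2 (T.flow s x).2) 0 t :=
    fun t => by
    have h := T.hasDerivAt_flow_cutSpray t x
    have h1 := h.fst
    have h2 := h.snd
    refine (T.hasDerivAt_metric h1 h2 h2).congr_deriv ?_
    have e : (T.cutSpray (T.flow t x)).2
        + T.connection (T.flow t x).1 (T.cutSpray (T.flow t x)).1 (T.flow t x).2
        = (energyBump (T.metric (T.flow t x).1 (T.flow t x).2 (T.flow t x).2)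
          * T.lam (T.flow t x).1 (T.flow t x).2) • T.rot (T.flow t x).1 (T.flow t x).2 := by
      rw [T.connection_symm, cutSpray, Prod.smul_fst, Prod.smul_snd, connection_smul_right, spray,
        accel]
      module
    rw [e, metric_smul_left, metric_smul_right, metric_rot_self, metric_rot_left, metric_rot_self]
    ring
  have := is_const_of_deriv_eq_zero (fun t => (hd t).differentiableAt) (fun t => (hd t).deriv) t 0
  simpa [flow_zero] using this

/-- Equality near `q`, not only at `q`, is needed so that the linearizations agree as well. -/
lemma cutSpray_eventuallyEq {q : Plane × Plane} (hq : T.metric q.1 q.2 q.2 = 1) :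
    T.cutSpray =ᶠ[𝓝 q] T.spray := by
  have h1 : ∀ᶠ s in 𝓝 (T.metric q.1 q.2 q.2), energyBump s = 1 := by
    rw [hq]; exact energyBump.eventuallyEq_one
  have h2 : Filter.Tendsto (fun q : Plane × Plane => T.metric q.1 q.2 q.2) (𝓝 q)
      (𝓝 (T.metric q.1 q.2 q.2)) := T.contDiff_metric.continuous.tendsto q
  filter_upwards [h2.eventually h1] with z hz
  rw [cutSpray, hz, one_smul]

variable {T} in
lemma hasDerivAt_flow {x : Plane × Plane} (hx : T.metric x.1 x.2 x.2 = 1) (t : ℝ) :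
    HasDerivAt (fun s => T.flow s x) (T.spray (T.flow t x)) t := by
  have h := T.hasDerivAt_flow_cutSpray t x
  rwa [(T.cutSpray_eventuallyEq ((T.metric_flow t x).trans hx)).eq_of_nhds] at h

variable {T} in
lemma isGeodesic_flow {x : Plane × Plane} (hx : T.metric x.1 x.2 x.2 = 1) :
    T.IsGeodesic (fun t => (T.flow t x).1) ∧
      deriv (fun t => (T.flow t x).1) = fun t => (T.flow t x).2 := by
  have h1 : ∀ t, HasDerivAt (fun t => (T.flow t x).1) (T.flow t x).2 t := fun t =>
    (hasDerivAt_flow hx t).fst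
  have h2 : ∀ t, HasDerivAt (fun t => (T.flow t x).2) (T.accel (T.flow t x).1 (T.flow t x).2) t :=
    fun t => (hasDerivAt_flow hx t).snd
  have e1 : deriv (fun t => (T.flow t x).1) = fun t => (T.flow t x).2 :=
    funext fun t => (h1 t).deriv
  have hcont : Continuous fun t => T.flow t x :=
    continuous_iff_continuousAt.2 fun t => (hasDerivAt_flow hx t).continuousAt
  refine ⟨⟨contDiff_two_of_hasDerivAt h1 h2
    ((continuous_snd.comp T.contDiff_spray.continuous).comp hcont), fun t => ?_, fun t => ?_⟩, e1⟩
  · rw [e1, metric_flow, hx]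
  · rw [acceleration, e1, (h2 t).deriv, accel, sub_add_cancel]

namespace IsGeodesic

variable {T} {c : ℝ → Plane} (h : T.IsGeodesic c)
include h

lemma hasDerivAt (t : ℝ) : HasDerivAt c (deriv c t) t :=
  (h.1.differentiable two_ne_zero t).hasDerivAt

lemma hasDerivAt_deriv (t : ℝ) : HasDerivAt (deriv c) (T.accel (c t) (deriv c t)) t := by
  have hd : ContDiff ℝ 1 (deriv c) := by
    have := h.1
    rw [show (2 : WithTop ℕ∞) = 1 + 1 by norm_num, contDiff_succ_iff_deriv] at this
    exact this.2.2
  refine (hd.differentiable one_ne_zero t).hasDerivAt.congr_deriv ?_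
  rw [accel, ← h.2.2 t, acceleration, add_sub_cancel_right]

/-- Thermostat geodesics are determined by their initial position and velocity. -/
lemma eq_flow : (fun t => (c t, deriv c t)) = fun t => T.flow t (c 0, deriv c 0) :=
  eq_of_hasDerivAt (F := T.spray) (t₀ := 0) (T.contDiff_spray.of_le (by simp))
    (fun t => (h.hasDerivAt t).prodMk (h.hasDerivAt_deriv t)) (hasDerivAt_flow (h.2.1 0))
    (T.flow_zero _).symm

lemma comp_add_const (a : ℝ) : T.IsGeodesic (fun t => c (t + a)) ∧
    deriv (fun t => c (t + a)) = fun t => deriv c (t + a) := by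
  have e : deriv (fun t => c (t + a)) = fun t => deriv c (t + a) :=
    funext fun t => deriv_comp_add_const c a t
  refine ⟨⟨h.1.comp (contDiff_id.add contDiff_const), fun t => ?_, fun t => ?_⟩, e⟩
  · rw [e]; exact h.2.1 (t + a)
  · have := h.2.2 (t + a)
    rw [acceleration] at this ⊢
    rw [e, deriv_comp_add_const (deriv c) a t]
    exact this

end IsGeodesic

variable {T} in
-- The flow supplies existence, and uniqueness makes the choice in the definition immaterial.
lemma geodesic_eq {p v : Plane} (hv : T.metric p v v = 1) :
    T.geodesic p v = fun t => (T.flow t (p, v)).1 := by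
  have hex : ∃ c : ℝ → Plane, T.IsGeodesic c ∧ c 0 = p ∧ deriv c 0 = v := by
    obtain ⟨h1, h2⟩ := isGeodesic_flow (T := T) (x := (p, v)) hv
    refine ⟨_, h1, by rw [flow_zero], by simp only [h2, flow_zero]⟩
  rw [geodesic, dif_pos hex]
  obtain ⟨h1, h2, h3⟩ := hex.choose_spec
  have := h1.eq_flow
  rw [h2, h3] at this
  funext t
  exact congrArg Prod.fst (congrFun this t)

lemma connection_zero_right (p u : Plane) : T.connection p u 0 = 0 := by
  ext i; simp [connection_apply]

/-- The vertical variation field along the geodesic with initial data `x`. -/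
def variationField (x : Plane × Plane) (t : ℝ) : Plane × Plane :=
  fderiv ℝ (T.flow t) x (0, T.rot x.1 x.2)

variable {T} in
-- The differential of the flow solves the linearized equation. The initial vector `(0, iv)` is
-- vertical, so initially `J = 0` and `D_t J = iv` is normal to `v`.
lemma isVariation_flow {x : Plane × Plane} (hx : T.metric x.1 x.2 x.2 = 1) :
    T.IsVariation (fun t => (T.flow t x).1) (fun t => (T.flow t x).2)
      (fun t => (T.variationField x t).1) (fun t => (T.variationField x t).2) := by
  have h0 : T.flow 0 = id := funext T.flow_zero
  have hv0 : T.variationField x 0 = (0, T.rot x.1 x.2) := by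
    rw [variationField, h0, fderiv_id]; rfl
  have hd : ∀ t, HasDerivAt (T.variationField x)
      ((T.variationField x t).2, T.dspray (T.flow t x).1 (T.flow t x).2 (T.variationField x t).1
        (T.variationField x t).2) t := fun t => by
    have h := hasDerivAt_fderiv_flow T.contDiff_cutSpray T.flow_zero T.hasDerivAt_flow_cutSpray x
      (0, T.rot x.1 x.2) t
    rw [(T.cutSpray_eventuallyEq ((T.metric_flow t x).trans hx)).fderiv_eq] at h
    rw [← fderiv_spray]
    exact h
  refine ⟨fun t => (hasDerivAt_flow hx t).fst, fun t => (hasDerivAt_flow hx t).snd,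
    fun t => (hd t).fst, fun t => (hd t).snd, fun t => (T.metric_flow t x).trans hx, ?_⟩
  simp only [hv0, flow_zero]
  rw [connection_zero_right, add_zero, metric_rot_left, metric_rot_self, neg_zero]

/-- The normal component of the vertical variation field. -/
def jacobiField (x : Plane × Plane) (t : ℝ) : ℝ :=
  T.metric (T.flow t x).1 (T.variationField x t).1 (T.rot (T.flow t x).1 (T.flow t x).2)

variable {T} in
lemma jacobiField_spec {x : Plane × Plane} (hx : T.metric x.1 x.2 x.2 = 1) :
    T.IsJacobiSolution (fun t => (T.flow t x).1) (T.jacobiField x) ∧ T.jacobiField x 0 = 0 ∧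
      deriv (T.jacobiField x) 0 = 1 := by
  have h := isVariation_flow hx
  have h0 : T.flow 0 = id := funext T.flow_zero
  have hv0 : T.variationField x 0 = (0, T.rot x.1 x.2) := by
    rw [variationField, h0, fderiv_id]; rfl
  refine ⟨h.isJacobiSolution, ?_, (h.hasDerivAt_normal 0).deriv.trans ?_⟩
  · simp [jacobiField, hv0, metric_eq]
  · simp only [hv0, flow_zero]
    have e' : T.metric x.1 0 x.2 = 0 := by simp [metric_eq]
    rw [connection_zero_right, e', add_zero, metric_rot_rot, hx]
    ring

end Thermostat

end Flow

/-! ### The exponential map and conjugate points -/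

section Exponential

open Set
open scoped Topology

/-- The inverse function theorem: a smooth map on an open set with injective differentials is a
local diffeomorphism. -/
lemma isLocalDiffeomorphAt_of_injective_fderiv {E : Type*} [NormedAddCommGroup E] [NormedSpace ℝ E]
    [FiniteDimensional ℝ E] {f : E → E} {s : Set E} (hs : IsOpen s) (hf : ContDiffOn ℝ ∞ f s)
    (hinj : ∀ x ∈ s, Function.Injective (fderiv ℝ f x)) {x : E} (hx : x ∈ s) :
    IsLocalDiffeomorphAt 𝓘(ℝ, E) 𝓘(ℝ, E) ∞ f x := by
  have hat : ∀ y ∈ s, ContDiffAt ℝ ∞ f y := fun y hy => hf.contDiffAt (hs.mem_nhds hy)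
  have hequiv : ∀ y ∈ s, ∃ L : E ≃L[ℝ] E, HasFDerivAt f (L : E →L[ℝ] E) y := fun y hy => by
    refine ⟨(LinearEquiv.ofInjectiveEndo (fderiv ℝ f y : E →ₗ[ℝ] E)
      (hinj y hy)).toContinuousLinearEquiv, ?_⟩
    refine ((hat y hy).differentiableAt (by simp)).hasFDerivAt.congr_fderiv ?_
    ext; rfl
  obtain ⟨L, hL⟩ := hequiv x hx
  -- Restricting the local inverse to `s` ensures an invertible differential at every source point,
  -- hence a smooth inverse on the whole target.
  set e := ((hat x hx).toOpenPartialHomeomorph f hL (by simp)).restrOpen s hs with he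
  have hes : e.source ⊆ s := by
    rw [he, OpenPartialHomeomorph.restrOpen_source]; exact inter_subset_right
  have hxe : x ∈ e.source := by
    rw [he, OpenPartialHomeomorph.restrOpen_source]
    exact ⟨(hat x hx).mem_toOpenPartialHomeomorph_source hL (by simp), hx⟩
  refine ⟨⟨e.toPartialEquiv, e.open_source, e.open_target, ?_, ?_⟩, hxe, fun y _ => rfl⟩
  · exact (hf.mono hes).contMDiffOn
  · refine ContDiffOn.contMDiffOn fun y hy => ?_
    have hy' := hes (e.map_target hy)
    obtain ⟨L', hL'⟩ := hequiv _ hy'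
    exact (e.contDiffAt_symm hy hL' (hat _ hy')).contDiffWithinAt

namespace Thermostat

variable (T : Thermostat)

/-- The exponential map, lifted to the plane. -/
def liftedExp (p w : Plane) : Plane := (T.flow (T.gnorm p w) (p, (T.gnorm p w)⁻¹ • w)).1

lemma gnorm_pos (p : Plane) {w : Plane} (hw : w ≠ 0) : 0 < T.gnorm p w :=
  Real.sqrt_pos.2 (T.metric_pos p hw)

lemma metric_normalize (p : Plane) {w : Plane} (hw : w ≠ 0) :
    T.metric p ((T.gnorm p w)⁻¹ • w) ((T.gnorm p w)⁻¹ • w) = 1 := by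
  have h := T.gnorm_pos p hw
  rw [metric_smul_left, metric_smul_right, ← Real.sq_sqrt (T.metric_pos p hw).le]
  change (T.gnorm p w)⁻¹ * ((T.gnorm p w)⁻¹ * T.gnorm p w ^ 2) = 1
  field_simp

lemma gnorm_smul (p : Plane) {v : Plane} (hv : T.metric p v v = 1) {t : ℝ} (ht : 0 ≤ t) :
    T.gnorm p (t • v) = t := by
  rw [gnorm, metric_smul_left, metric_smul_right, hv, mul_one, Real.sqrt_mul_self ht]

lemma geodesic_zero (p v : Plane) : T.geodesic p v 0 = p := by
  rw [geodesic]
  split_ifs with h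
  · exact h.choose_spec.2.1
  · rfl

lemma exp_eq (p : Plane) : T.exp p = torusCover ∘ T.liftedExp p := by
  funext w
  rw [exp, Function.comp_apply, liftedExp]
  rcases eq_or_ne w 0 with rfl | hw
  · have h : T.gnorm p 0 = 0 := by simp [gnorm, metric_eq]
    rw [h, geodesic_zero, flow_zero]
  · rw [geodesic_eq (T.metric_normalize p hw)]

lemma liftedExp_smul (p : Plane) {v : Plane} (hv : T.metric p v v = 1) {t : ℝ} (ht : 0 < t) :
    T.liftedExp p (t • v) = (T.flow t (p, v)).1 := by
  rw [liftedExp, T.gnorm_smul p hv ht.le, inv_smul_smul₀ ht.ne']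

lemma contDiffOn_liftedExp (p : Plane) : ContDiffOn ℝ ∞ (T.liftedExp p) {w | w ≠ 0} := by
  intro w hw
  have hn : ContDiffAt ℝ ∞ (T.gnorm p) w := by
    have h : ContDiff ℝ ∞ fun w : Plane => T.metric p w w :=
      T.contDiff_metric.comp (contDiff_const.prodMk contDiff_id)
    exact h.contDiffAt.sqrt (T.metric_pos p hw).ne'
  refine ContDiffAt.contDiffWithinAt ?_
  have h := ContDiffAt.comp w (f := fun w => (T.gnorm p w, p, (T.gnorm p w)⁻¹ • w))
    (contDiff_fst.comp T.contDiff_flow).contDiffAt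
    (hn.prodMk (contDiffAt_const.prodMk ((hn.inv (T.gnorm_pos p hw).ne').smul contDiffAt_id)))
  exact h

variable {T} in
lemma ne_zero_of_unit {p v : Plane} (hv : T.metric p v v = 1) : v ≠ 0 := by
  rintro rfl
  simp [metric_eq] at hv

lemma differentiableAt_liftedExp (p : Plane) {w : Plane} (hw : w ≠ 0) :
    DifferentiableAt ℝ (T.liftedExp p) w :=
  ((T.contDiffOn_liftedExp p).contDiffAt (isOpen_ne.mem_nhds hw)).differentiableAt (by simp)

variable {T} in
-- Rays are mapped to geodesics parametrized by arc length.
lemma fderiv_liftedExp_radial {p v : Plane} (hv : T.metric p v v = 1) {t : ℝ} (ht : 0 < t) :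
    fderiv ℝ (T.liftedExp p) (t • v) v = (T.flow t (p, v)).2 := by
  have h1 : HasDerivAt (fun s : ℝ => T.liftedExp p (s • v))
      (fderiv ℝ (T.liftedExp p) (t • v) v) t := by
    refine HasFDerivAt.comp_hasDerivAt (f := fun s : ℝ => s • v) t (T.differentiableAt_liftedExp p
      (smul_ne_zero ht.ne' (ne_zero_of_unit hv))).hasFDerivAt ?_
    simpa using (hasDerivAt_id t).smul_const v
  have h2 : HasDerivAt (fun s => (T.flow s (p, v)).1) (T.flow t (p, v)).2 t :=
    (hasDerivAt_flow (x := (p, v)) hv t).fst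
  refine h1.unique (h2.congr_of_eventuallyEq ?_)
  filter_upwards [lt_mem_nhds ht] with s hs using T.liftedExp_smul p hv hs

variable {T} in
-- Differentiates along the circle of radius `t`. Rotating `v` keeps it a unit vector, so the
-- exponential map is the time `t` flow along the whole family.
lemma fderiv_liftedExp_angular {p v : Plane} (hv : T.metric p v v = 1) {t : ℝ} (ht : 0 < t) :
    fderiv ℝ (T.liftedExp p) (t • v) (t • T.rot p v) = (T.variationField (p, v) t).1 := by
  have hA : HasDerivAt (fun θ : ℝ => Real.cos θ • v + Real.sin θ • T.rot p v) (T.rot p v) 0 := by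
    refine (((Real.hasDerivAt_cos 0).smul_const v).add
      ((Real.hasDerivAt_sin 0).smul_const (T.rot p v))).congr_deriv ?_
    simp
  have hA0 : Real.cos 0 • v + Real.sin 0 • T.rot p v = v := by simp
  have hunit : ∀ θ : ℝ, T.metric p (Real.cos θ • v + Real.sin θ • T.rot p v)
      (Real.cos θ • v + Real.sin θ • T.rot p v) = 1 := fun θ => by
    have h : T.metric p (T.rot p v) v = 0 := by rw [metric_rot_left, metric_rot_self, neg_zero]
    simp only [metric_add_left, metric_add_right, metric_smul_left, metric_smul_right,
      metric_rot_rot, metric_rot_self, h, hv]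
    linear_combination Real.sin_sq_add_cos_sq θ
  have h1 : HasDerivAt (fun θ : ℝ => T.liftedExp p (t • (Real.cos θ • v + Real.sin θ • T.rot p v)))
      (fderiv ℝ (T.liftedExp p) (t • v) (t • T.rot p v)) 0 := by
    refine HasFDerivAt.comp_hasDerivAt (l := T.liftedExp p)
      (f := fun θ : ℝ => t • (Real.cos θ • v + Real.sin θ • T.rot p v)) 0 ?_ (hA.const_smul t)
    rw [hA0]
    exact (T.differentiableAt_liftedExp p (smul_ne_zero ht.ne' (ne_zero_of_unit hv))).hasFDerivAt
  have hd : DifferentiableAt ℝ (T.flow t) (p, v) :=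
    ((T.contDiff_flow.comp (contDiff_const.prodMk contDiff_id)).differentiable (by simp)) (p, v)
  have h2 : HasDerivAt
      (fun θ : ℝ => T.flow t (p, Real.cos θ • v + Real.sin θ • T.rot p v))
      (T.variationField (p, v) t) 0 := by
    refine HasFDerivAt.comp_hasDerivAt (l := T.flow t)
      (f := fun θ : ℝ => (p, Real.cos θ • v + Real.sin θ • T.rot p v)) 0 ?_
      ((hasDerivAt_const 0 p).prodMk hA)
    rw [hA0]
    exact hd.hasFDerivAt
  simp_rw [T.liftedExp_smul p (hunit _) ht] at h1
  exact h1.unique h2.fst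

/-- The lifted exponential map is an immersion at `tv` if and only if the Jacobi field along the
geodesic through `v` that vanishes at time `0` does not vanish at time `t`. -/
lemma injective_fderiv_liftedExp_iff {p v : Plane} (hv : T.metric p v v = 1) {t : ℝ} (ht : 0 < t) :
    Function.Injective (fderiv ℝ (T.liftedExp p) (t • v)) ↔ T.jacobiField (p, v) t ≠ 0 := by
  set L := fderiv ℝ (T.liftedExp p) (t • v)
  have hrad : L v = (T.flow t (p, v)).2 := fderiv_liftedExp_radial hv ht
  have hang : L (t • T.rot p v) = (T.variationField (p, v) t).1 := fderiv_liftedExp_angular hv ht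
  have hunit : T.metric (T.flow t (p, v)).1 (T.flow t (p, v)).2 (T.flow t (p, v)).2 = 1 :=
    (T.metric_flow t (p, v)).trans hv
  constructor
  · intro hinj hy
    -- If the normal component vanishes, `L (t • iv)` is a multiple of `L v`; injectivity would make
    -- `t • iv` a multiple of `v`, forcing `t = 0`.
    have h := T.eq_metric_smul_add (T.flow t (p, v)).1 (T.variationField (p, v) t).1 hunit
    rw [show T.metric (T.flow t (p, v)).1 (T.variationField (p, v) t).1
      (T.rot (T.flow t (p, v)).1 (T.flow t (p, v)).2) = 0 from hy, zero_smul, add_zero, ← hang,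
      ← hrad, ← map_smul] at h
    have h' := congrArg (fun w => T.metric p w (T.rot p v)) (hinj h)
    simp only [metric_smul_left, metric_rot_rot, metric_rot_self, hv] at h'
    linarith
  · intro hy
    rw [injective_iff_map_eq_zero]
    intro z hz
    have hzdec := T.eq_metric_smul_add p z hv
    set a := T.metric p z v
    set b := T.metric p z (T.rot p v)
    -- In the basis `v, t • iv` the map `L` is triangular with respect to the frame at the end
    -- point, with diagonal entries `1` and the Jacobi field.
    have hz' : z = a • v + (b / t) • (t • T.rot p v) := by
      rw [smul_smul, div_mul_cancel₀ _ ht.ne']; exact hzdec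
    rw [hz', map_add, map_smul, map_smul, hrad, hang] at hz
    have h1 := congrArg (fun w => T.metric (T.flow t (p, v)).1 w
      (T.rot (T.flow t (p, v)).1 (T.flow t (p, v)).2)) hz
    have h2 : ∀ u, T.metric (T.flow t (p, v)).1 0 u = 0 := fun u => by simp [metric_eq]
    simp only [metric_add_left, metric_smul_left, metric_rot_self, h2, mul_zero, zero_add] at h1
    have hb : b / t = 0 := (mul_eq_zero.1 h1).resolve_right hy
    rw [hb, zero_smul, add_zero] at hz
    have h3 := congrArg (fun w => T.metric (T.flow t (p, v)).1 w (T.flow t (p, v)).2) hz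
    simp only [metric_smul_left, hunit, h2, mul_one] at h3
    rw [hz', hb, h3, zero_smul, zero_smul, add_zero]

/-- A Jacobi field vanishing at a time is a multiple of the Jacobi field of the flow. -/
lemma IsJacobiSolution.eq_smul_jacobiField {T : Thermostat} {c : ℝ → Plane} (hc : T.IsGeodesic c)
    {y : ℝ → ℝ} (hy : T.IsJacobiSolution c y) {a : ℝ} (ha : y a = 0) (t : ℝ) :
    y (t + a) = deriv y a * T.jacobiField (c a, deriv c a) t := by
  obtain ⟨hca, hca'⟩ := hc.comp_add_const a
  have hflow := hca.eq_flow
  simp only [hca', zero_add] at hflow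
  have hfst : (fun t => (T.flow t (c a, deriv c a)).1) = fun t => c (t + a) :=
    funext fun t => congrArg Prod.fst (congrFun hflow t).symm
  obtain ⟨hz, hz0, hz1⟩ := jacobiField_spec (T := T) (x := (c a, deriv c a)) (hc.2.1 a)
  rw [hfst] at hz
  obtain ⟨hp, hq⟩ := T.continuous_jacobi_coefficients
    (c := fun t => c (t + a)) (v := fun t => deriv c (t + a))
    (hc.1.continuous.comp (continuous_id.add continuous_const))
    ((hc.1.continuous_deriv one_le_two).comp (continuous_id.add continuous_const))
  set z := T.jacobiField (c a, deriv c a)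
  have e : deriv (fun t => y (t + a)) = fun t => deriv y (t + a) :=
    funext fun t => deriv_comp_add_const y a t
  have e' : deriv (fun t => deriv y a * z t) = fun t => deriv y a * deriv z t :=
    funext fun t => deriv_const_mul_field _
  -- Both functions solve the equation along the shifted geodesic, with value `0` and derivative
  -- `deriv y a` at time `0`.
  refine congrFun (eq_of_second_order_linear hp hq (y := fun t => y (t + a))
    (z := fun t => deriv y a * z t) (t₀ := 0)
    (hy.1.comp (contDiff_id.add contDiff_const)) (contDiff_const.mul hz.1) (fun t => ?_)
    (fun t => ?_) ?_ ?_) t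
  · rw [e, deriv_comp_add_const (deriv y) a t]
    exact hy.2 (t + a)
  · have h := hz.2 t
    rw [hca'] at h
    rw [e', deriv_const_mul_field]
    linear_combination deriv y a * h
  · simp [ha, hz0]
  · simp [e, e', hz1]

/-- The exponential map is a local diffeomorphism where its lift is an immersion. -/
lemma isLocalDiffeomorphOn_exp_iff (p : Plane) :
    IsLocalDiffeomorphOn 𝓘(ℝ, Plane) torusI ∞ (T.exp p) {w | w ≠ 0} ↔
      ∀ w ≠ 0, Function.Injective (fderiv ℝ (T.liftedExp p) w) := by
  rw [exp_eq]
  constructor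
  · intro h w hw
    have hinj : Function.Injective
        (mfderiv 𝓘(ℝ, Plane) torusI (torusCover ∘ T.liftedExp p) w) :=
      ((h ⟨w, hw⟩).mfderivToContinuousLinearEquiv (by simp)).injective
    have hd := (((contMDiff_torusCover (T.liftedExp p w)).mdifferentiableAt
      (by simp)).hasMFDerivAt).comp w (T.differentiableAt_liftedExp p hw).hasFDerivAt.hasMFDerivAt
    rw [hd.mfderiv] at hinj
    -- The differential of the composite is injective, hence so is its inner factor.
    exact Function.Injective.of_comp (f := pushL (T.liftedExp p w)) hinj
  · rintro h ⟨w, hw⟩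
    exact (isLocalDiffeomorphAt_of_injective_fderiv isOpen_ne (T.contDiffOn_liftedExp p) h hw).comp
      torusI _ (isLocalDiffeomorphAt_torusCover _)

/-- Polar coordinates: every nonzero vector is its positive norm times a unit vector, so the
pointwise criterion covers the whole domain. -/
lemma noConjugatePoints_iff : T.NoConjugatePoints ↔
    ∀ p v : Plane, T.metric p v v = 1 → ∀ t > 0, T.jacobiField (p, v) t ≠ 0 := by
  constructor
  · intro h p v hv t ht
    exact (T.injective_fderiv_liftedExp_iff hv ht).1 ((T.isLocalDiffeomorphOn_exp_iff p).1 (h p) _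
      (smul_ne_zero ht.ne' (ne_zero_of_unit hv)))
  · intro h p
    refine (T.isLocalDiffeomorphOn_exp_iff p).2 fun w hw => ?_
    have hw' := (T.injective_fderiv_liftedExp_iff (T.metric_normalize p hw) (T.gnorm_pos p hw)).2
      (h p _ (T.metric_normalize p hw) _ (T.gnorm_pos p hw))
    rwa [smul_inv_smul₀ (T.gnorm_pos p hw).ne'] at hw'

end Thermostat

end Exponential

end

/-! ### The main theorem -/

theorem mainTheorem2 (T : Thermostat) :
    T.NoConjugatePoints ↔
      ∀ c : ℝ → Plane, T.IsGeodesic c →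
        ∀ y : ℝ → ℝ, T.IsJacobiSolution c y → (∃ t, y t ≠ 0) →
          ∀ a b : ℝ, y a = 0 → y b = 0 → a = b := by
  rw [T.noConjugatePoints_iff]
  constructor
  · intro h c hc y hy ⟨s, hs⟩
    -- A second zero would make the multiple `deriv y a` vanish, as the special solution is nonzero
    -- at time `b - a > 0`; then `y` vanishes identically.
    have key : ∀ a b : ℝ, a < b → y a = 0 → y b ≠ 0 := by
      intro a b hab ha hb
      have hz := hy.eq_smul_jacobiField hc ha
      have hne := h (c a) (deriv c a) (hc.2.1 a) (b - a) (sub_pos.2 hab)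
      have h1 := hz (b - a)
      rw [sub_add_cancel, hb, eq_comm, mul_eq_zero, or_iff_left hne] at h1
      refine hs ?_
      have h2 := hz (s - a)
      rwa [sub_add_cancel, h1, zero_mul] at h2
    intro a b ha hb
    rcases lt_trichotomy a b with hab | hab | hab
    · exact absurd hb (key a b hab ha)
    · exact hab
    · exact absurd ha (key b a hab hb)
  · intro h p v hv t ht hzero
    obtain ⟨hy, h0, h1⟩ := T.jacobiField_spec (x := (p, v)) hv
    refine ht.ne (h _ (T.isGeodesic_flow (x := (p, v)) hv).1 _ hy ?_ 0 t h0 hzero)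
    -- The slope `1` at time `0` excludes the zero solution, so the zeros `0` and `t` contradict the
    -- assumption.
    by_contra! hall
    rw [show T.jacobiField (p, v) = fun _ => 0 from funext hall] at h1
    simp at h1
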